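/- Let $B_m$ denote the Bernoulli numbers, $\frac{x}{e^x-1}=\sum_{m\ge 0}\frac{B_m}{m!}x^m$ for $|x|<2\pi$; let $S_k^{(1)}(l)$ denote the (signed) Stirling numbers of the first kind, defined by $x(x+1)\cdots(x+k-1)=(-1)^k\sum_{l=0}^{k}(-1)^l S_k^{(1)}(l)\,x^l$; let $\zeta$ be the Riemann zeta function; and let $(2m-1)!!=1\cdot 3\cdots(2m-1)$ with $(-1)!!=1$. Then for every natural number $n\ge 1$ the following two series converge (absolutely), and $$\sum_{k=1}^{n}\frac{1}{\sqrt{k}}=2\sqrt{n}+\zeta\left(\tfrac12\right)+\frac{1}{2\sqrt{n}}+\sum_{k=1}^{\infty}(-1)^{k+1}\frac{\sum_{l=1}^{k}(-1)^{l}\frac{(2l-1)!!}{2^{l}(l+1)!}B_{l+1}S_{k}^{(1)}(l)}{\sqrt{n}\,(n+1)(n+2)\cdots(n+k)}$$ $$=2\sqrt{n}+\zeta\left(\tfrac12\right)+\frac{1}{2\sqrt{n}}-\frac{1}{24\sqrt{n}(n+1)}-\frac{1}{24\sqrt{n}(n+1)(n+2)}-\frac{31}{384\sqrt{n}(n+1)(n+2)(n+3)}-\frac{15}{64\sqrt{n}(n+1)(n+2)(n+3)(n+4)}-\ldots$$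 and $$\sum_{k=1}^{n}\frac{1}{\sqrt{k}}=2\sqrt{n}+\zeta\left(\tfrac12\right)+\sqrt{n}\sum_{k=1}^{\infty}(-1)^{k+1}\frac{\sum_{l=1}^{k}(-1)^{l}\frac{(2l-3)!!}{2^{l-1}\,l!}B_{l}S_{k}^{(1)}(l)}{(n+1)(n+2)\cdots(n+k)}$$ $$=2\sqrt{n}+\zeta\left(\tfrac12\right)+\frac{\sqrt{n}}{2(n+1)}+\frac{11\sqrt{n}}{24(n+1)(n+2)}+\frac{7\sqrt{n}}{8(n+1)(n+2)(n+3)}+\frac{977\sqrt{n}}{384(n+1)(n+2)(n+3)(n+4)}+\ldots,$$ where the displayed terms are those of the respective series for $k=1,2,3,4$. -/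

import Mathlib

open scoped Nat

/-- The signed Stirling number of the first kind `S_k^{(1)}(l)`, obtained from Mathlib's unsigned
`Nat.stirlingFirst` by the sign `(-1)^(k+l)`. -/
def stirlingS (k l : ℕ) : ℤ := (-1) ^ (k + l) * (Nat.stirlingFirst k l : ℤ)

/-- The defining identity `(x)_k = (-1)^k ∑_{l=0}^k (-1)^l S_k^{(1)}(l) x^l`
of the signed Stirling numbers of the first kind, where `(x)_k` is the rising factorial. -/
theorem ascPochhammer_eval_eq_stirlingS (k : ℕ) (x : ℝ) :
    (ascPochhammer ℝ k).eval x =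
      (-1) ^ k * ∑ l ∈ Finset.range (k + 1), (-1) ^ l * (stirlingS k l : ℝ) * x ^ l := by
  have key : ∀ k : ℕ, (ascPochhammer ℝ k).eval x =
      ∑ l ∈ Finset.range (k + 1), (Nat.stirlingFirst k l : ℝ) * x ^ l := by
    intro k
    induction k with
    | zero => simp
    | succ k ih =>
      rw [ascPochhammer_succ_eval, ih, Finset.sum_range_succ' _ (k + 1)]
      simp only [Nat.stirlingFirst_succ_succ, Nat.stirlingFirst_succ_zero]
      push_cast
      simp only [add_mul, Finset.sum_add_distrib, mul_add]
      have h1 : ∑ l ∈ Finset.range (k + 1), (k : ℝ) * (Nat.stirlingFirst k (l + 1)) * x ^ (l + 1)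
          = (∑ l ∈ Finset.range (k + 1), (Nat.stirlingFirst k l : ℝ) * x ^ l) * k := by
        have h2 := Finset.sum_range_succ'
          (fun l => (k : ℝ) * (Nat.stirlingFirst k l : ℝ) * x ^ l) (k + 1)
        rw [Finset.sum_range_succ, Nat.stirlingFirst_eq_zero_of_lt (Nat.lt_succ_self k)] at h2
        have h3 : (k : ℝ) * (Nat.stirlingFirst k 0 : ℝ) = 0 := by
          cases k <;> simp
        rw [h3] at h2
        rw [Finset.sum_mul]
        simp only [Nat.cast_zero, mul_zero, zero_mul, add_zero] at h2
        rw [← h2]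
        exact Finset.sum_congr rfl fun l _ => by ring
      rw [h1, Finset.sum_mul]
      simp only [pow_succ, mul_assoc, Nat.cast_zero, zero_mul, add_zero]
      ring
  rw [key, Finset.mul_sum]
  refine Finset.sum_congr rfl fun l _ => ?_
  have h : ((-1 : ℝ) ^ k * (-1) ^ l) * ((-1) ^ k * (-1) ^ l) = 1 := by
    rw [← pow_add, ← pow_add]
    exact Even.neg_one_pow ⟨k + l, rfl⟩
  simp only [stirlingS, Int.cast_mul, Int.cast_pow, Int.cast_neg, Int.cast_one,
    Int.cast_natCast, pow_add]
  linear_combination (-(Nat.stirlingFirst k l : ℝ) * x ^ l) * h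

/-- `(-1)^(k+1) ∑_{l=1}^k (-1)^l (2l-1)!! / (2^l (l+1)!) B_{l+1} S_k^{(1)}(l)`.
(`bernoulli` has generating function `x / (e^x - 1)`; here `l ≥ 1`, so `2 * l - 1` does not
truncate.) -/
def invSqrtCoeff₁ (k : ℕ) : ℚ :=
  (-1) ^ (k + 1) * ∑ l ∈ Finset.Icc 1 k,
    (-1) ^ l * (((2 * l - 1)‼ : ℚ) / (2 ^ l * ((l + 1)! : ℚ))) *
      bernoulli (l + 1) * (stirlingS k l : ℚ)

/-- `(-1)^(k+1) ∑_{l=1}^k (-1)^l (2l-3)!! / (2^(l-1) l!) B_l S_k^{(1)}(l)`.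
The convention `(-1)!! = 1` applies at `l = 1`; the truncated value `0‼ = 1` agrees with it. -/
def invSqrtCoeff₂ (k : ℕ) : ℚ :=
  (-1) ^ (k + 1) * ∑ l ∈ Finset.Icc 1 k,
    (-1) ^ l * (((2 * l - 3)‼ : ℚ) / (2 ^ (l - 1) * (l ! : ℚ))) *
      bernoulli l * (stirlingS k l : ℚ)

/-- The product `(n+1)(n+2)⋯(n+k)`. -/
def shiftedRising (n k : ℕ) : ℝ := ∏ j ∈ Finset.Icc 1 k, ((n : ℝ) + (j : ℝ))

/-! Put g(u) = 1/u - 1/(eᵘ - 1) and G(r) = ∫₀^∞ e^{-ru} u^{-1/2} g(u) du. Both series are expansions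
of G(n), because ∑_{k≤n} k^{-1/2} = 2√n + ζ(1/2) + G(n)/√π: an integration by parts computes G(r) -
G(r+1), so the difference of the two sides does not depend on n, and letting n → ∞ shows that it
vanishes (`sum_inv_sqrt_eq`).

To expand G(n), set w = 1 - e^{-t}. Then 1/2 - g(vt) is a power series in w whose coefficients
`gregoryPoly k v` are polynomials in v built from Bernoulli and Stirling numbers, and e^{-nt} wᵏ
integrates to k!/(n(n+1)⋯(n+k)). The weight u^{-1/2} comes from a Gaussian integral over y, which
amounts to averaging over v = 1/(1+y²); the moments of v supply the double factorials
(`hasSum_invSqrtWeight`).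

The termwise integrations rest on positivity: `gregoryPoly k v` is nonnegative for 0 < v ≤ 1. The
reciprocal of ((1-w)⁻ᵛ - 1)/(vw) satisfies a Riccati equation, whose coefficient recursion has
nonnegative terms and a source (1-v²)/4 that decreases in v; for k ≥ 1, v times the polynomial is
the difference of the coefficients at parameters 0 and v (`powerQuotRem_coeff_le`,
`mul_gregoryPoly`). Letting w → 1 bounds the sum of the polynomials by 1/2.

The second series follows from the first by summation by parts: by the Stirling recurrence its
coefficients are factorials times 1/2 minus partial sums of the weights of the first
(`invSqrtCoeff₂_succ_eq`). -/

/-! ### Substitution of -log(1 - X) as a ring homomorphism -/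

open PowerSeries in
/-- The substitution `X ↦ -log (1 - X)` on formal power series, written through the Stirling
numbers of the first kind. -/
noncomputable def stirlingTransform (F : PowerSeries ℝ) : PowerSeries ℝ :=
  PowerSeries.mk fun k =>
    (∑ l ∈ Finset.range (k + 1), (Nat.stirlingFirst k l : ℝ) * (l ! : ℝ) * coeff l F) / (k ! : ℝ)

namespace stirlingTransform

open PowerSeries

/-- The chain rule for -log(1 - X), whose derivative is 1/(1 - X), read off coefficientwise from the
Stirling recurrence. -/
theorem coeff_succ (F : PowerSeries ℝ) (k : ℕ) :
    ((k : ℝ) + 1) * coeff (k + 1) (stirlingTransform F) =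
      k * coeff k (stirlingTransform F) + coeff k (stirlingTransform (derivative ℝ F)) := by
  have hk : (k ! : ℝ) ≠ 0 := by positivity
  have hk1 : (k : ℝ) + 1 ≠ 0 := by positivity
  have h0 : (k : ℝ) * (Nat.stirlingFirst k 0 : ℝ) = 0 := by cases k <;> simp
  have h2 := Finset.sum_range_succ'
    (fun l => (k : ℝ) * ((Nat.stirlingFirst k l : ℝ) * (l ! : ℝ) * coeff l F)) (k + 1)
  rw [Finset.sum_range_succ, Nat.stirlingFirst_eq_zero_of_lt (Nat.lt_succ_self k)] at h2
  have h3 : (k : ℝ) * ((Nat.stirlingFirst k 0 : ℝ) * ((0 ! : ℕ) : ℝ) * coeff 0 F) = 0 := by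
    rw [mul_assoc, ← mul_assoc, h0, zero_mul]
  rw [h3] at h2
  simp only [Nat.cast_zero, zero_mul, mul_zero, add_zero] at h2
  simp only [stirlingTransform, coeff_mk, coeff_derivative]
  rw [Finset.sum_range_succ' _ (k + 1)]
  simp only [Nat.stirlingFirst_succ_succ, Nat.stirlingFirst_succ_zero, Nat.factorial_succ]
  rw [mul_div_assoc', mul_div_assoc', ← add_div, Nat.cast_mul, Nat.cast_succ,
    mul_div_mul_left _ _ hk1, Finset.mul_sum, h2, ← Finset.sum_add_distrib]
  congr 1
  simp only [Nat.cast_zero, zero_mul, add_zero]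
  refine Finset.sum_congr rfl fun l _ => ?_
  rw [Nat.factorial_succ]
  push_cast
  ring

theorem coeff_zero' (F : PowerSeries ℝ) :
    coeff 0 (stirlingTransform F) = coeff 0 F := by
  simp [stirlingTransform]

theorem one_sub_X_mul_derivative (F : PowerSeries ℝ) :
    (1 - X) * derivative ℝ (stirlingTransform F) = stirlingTransform (derivative ℝ F) := by
  ext k
  have h := coeff_succ F k
  rw [sub_mul, one_mul, map_sub, coeff_derivative]
  cases k with
  | zero => simp at h ⊢; exact h
  | succ k =>
    rw [PowerSeries.coeff_succ_X_mul, coeff_derivative]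
    push_cast at h ⊢
    linear_combination h

theorem map_add' (F G : PowerSeries ℝ) :
    stirlingTransform (F + G) = stirlingTransform F + stirlingTransform G := by
  ext k
  simp [stirlingTransform, mul_add, Finset.sum_add_distrib, add_div]

/-- Both sides obey the same first-order equation with the same constant term. The induction runs
over all F and G at once, since the step applies it to their derivatives. -/
theorem map_mul' (F G : PowerSeries ℝ) :
    stirlingTransform (F * G) = stirlingTransform F * stirlingTransform G := by
  ext k
  induction k generalizing F G with
  | zero =>
    have := coeff_zero' F
    have := coeff_zero' G
    have := coeff_zero' (F * G)
    simp_all [coeff_zero_eq_constantCoeff]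
  | succ k ih =>
    have h1 := coeff_succ (F * G) k
    have h2 : (1 - X) * derivative ℝ (stirlingTransform F * stirlingTransform G) =
        stirlingTransform F * stirlingTransform (derivative ℝ G) +
          stirlingTransform G * stirlingTransform (derivative ℝ F) := by
      rw [← one_sub_X_mul_derivative, ← one_sub_X_mul_derivative, Derivation.leibniz,
        smul_eq_mul, smul_eq_mul]
      ring
    have h3 : ((k : ℝ) + 1) * coeff (k + 1) (stirlingTransform F * stirlingTransform G) =
        k * coeff k (stirlingTransform F * stirlingTransform G) +
          coeff k ((1 - X) * derivative ℝ (stirlingTransform F * stirlingTransform G)) := by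
      rw [sub_mul, one_mul, map_sub, coeff_derivative]
      cases k with
      | zero => simp
      | succ k =>
        rw [PowerSeries.coeff_succ_X_mul, coeff_derivative]
        push_cast
        ring
    rw [h2, map_add, ← ih F (derivative ℝ G), ← ih G (derivative ℝ F)] at h3
    rw [Derivation.leibniz, smul_eq_mul, smul_eq_mul, map_add', map_add, ih F G] at h1
    have hk : (k : ℝ) + 1 ≠ 0 := by positivity
    exact mul_left_cancel₀ hk (h1.trans h3.symm)

theorem map_one' : stirlingTransform 1 = 1 := by
  ext k
  cases k with
  | zero => simp [coeff_zero']
  | succ k =>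
    simp only [stirlingTransform, coeff_mk, coeff_one]
    rw [if_neg (Nat.succ_ne_zero k), Finset.sum_eq_zero, zero_div]
    intro l _
    cases l with
    | zero => simp
    | succ l => simp

theorem map_C' (a : ℝ) : stirlingTransform (C a) = C a := by
  have h : stirlingTransform (C a * 1) = C a * stirlingTransform 1 := by
    ext k
    simp only [stirlingTransform, coeff_mk, coeff_C_mul]
    rw [mul_div_assoc', Finset.mul_sum]
    congr 1
    exact Finset.sum_congr rfl fun l _ => by ring
  rwa [mul_one, map_one', mul_one] at h

end stirlingTransform

/-! ### The binomial quotient, its reciprocal and a Riccati equation -/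

/-- Coefficients of `((1 - w)⁻ᵛ - 1) / (v w)`, and of `-log (1 - w) / w` when `v = 0`. -/
noncomputable def powerQuotCoeff (v : ℝ) (k : ℕ) : ℝ :=
  ∏ j ∈ Finset.range k, ((j : ℝ) + 1 + v) / ((j : ℝ) + 2)

theorem powerQuotCoeff_zero (v : ℝ) : powerQuotCoeff v 0 = 1 := by simp [powerQuotCoeff]

theorem powerQuotCoeff_succ (v : ℝ) (k : ℕ) :
    ((k : ℝ) + 2) * powerQuotCoeff v (k + 1) = ((k : ℝ) + 1 + v) * powerQuotCoeff v k := by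
  have : (k : ℝ) + 2 ≠ 0 := by positivity
  rw [powerQuotCoeff, Finset.prod_range_succ, ← powerQuotCoeff]
  field_simp

theorem powerQuotCoeff_nonneg {v : ℝ} (hv : 0 ≤ v) (k : ℕ) : 0 ≤ powerQuotCoeff v k :=
  Finset.prod_nonneg fun j _ => by positivity

theorem powerQuotCoeff_le_one {v : ℝ} (hv : 0 ≤ v) (hv1 : v ≤ 1) (k : ℕ) :
    powerQuotCoeff v k ≤ 1 :=
  Finset.prod_le_one (fun j _ => by positivity) fun j _ => by
    rw [div_le_one (by positivity)]; linarith

theorem powerQuotCoeff_at_zero (k : ℕ) : powerQuotCoeff 0 k = 1 / ((k : ℝ) + 1) := by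
  induction k with
  | zero => simp [powerQuotCoeff]
  | succ k ih =>
    have h := powerQuotCoeff_succ 0 k
    rw [ih] at h
    have : (k : ℝ) + 2 ≠ 0 := by positivity
    have : (k : ℝ) + 1 ≠ 0 := by positivity
    push_cast
    rw [eq_div_iff (by positivity)]
    rw [add_zero, mul_one_div_cancel this] at h
    linear_combination h

theorem ascPochhammer_eval_eq_powerQuotCoeff (v : ℝ) (k : ℕ) :
    (ascPochhammer ℝ (k + 1)).eval v / ((k + 1)! : ℝ) = v * powerQuotCoeff v k := by
  induction k with
  | zero => simp [powerQuotCoeff]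
  | succ k ih =>
    have h := powerQuotCoeff_succ v k
    rw [ascPochhammer_succ_eval, Nat.factorial_succ (k + 1)]
    have : ((k + 1)! : ℝ) ≠ 0 := by positivity
    rw [div_eq_iff (by positivity)] at ih ⊢
    rw [ih]
    push_cast
    linear_combination (-v * ((k + 1)! : ℝ)) * h

/-- The power series `((1 - w)⁻ᵛ - 1) / (v w)`. -/
noncomputable def powerQuot (v : ℝ) : PowerSeries ℝ := PowerSeries.mk (powerQuotCoeff v)

section
open PowerSeries

/-- This is (1 - w) y' = v y for y = (1 - w)⁻ᵛ = 1 + v w c, with a factor v cancelled; the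
coefficientwise proof keeps it valid at v = 0. -/
theorem powerQuot_ode (v : ℝ) :
    (1 - X) * (powerQuot v + X * derivative ℝ (powerQuot v)) = 1 + C v * X * powerQuot v := by
  ext k
  cases k with
  | zero => simp [powerQuot, powerQuotCoeff]
  | succ k =>
    have h := powerQuotCoeff_succ v k
    have e1 : (1 - X) * (powerQuot v + X * derivative ℝ (powerQuot v)) =
      powerQuot v + X * derivative ℝ (powerQuot v) - X * powerQuot v
        - X * (X * derivative ℝ (powerQuot v)) := by ring
    have e2 : C v * X * powerQuot v = C v * (X * powerQuot v) := by ring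
    rw [e1, e2]
    simp only [map_sub, map_add, coeff_succ_X_mul, coeff_derivative, coeff_C_mul, coeff_one]
    rw [if_neg (Nat.succ_ne_zero k)]
    cases k with
    | zero =>
      simp [powerQuot] at h ⊢
      linear_combination h
    | succ k =>
      simp only [coeff_succ_X_mul, coeff_derivative, powerQuot, coeff_mk]
      push_cast at h ⊢
      linear_combination h

/-- The reciprocal of `powerQuot v`, i.e. the power series `v w / ((1 - w)⁻ᵛ - 1)`. -/
noncomputable def powerQuotInv (v : ℝ) : PowerSeries ℝ := (powerQuot v)⁻¹

theorem powerQuotInv_mul (v : ℝ) : powerQuotInv v * powerQuot v = 1 :=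
  PowerSeries.inv_mul_cancel _ (by
    simp [powerQuot, ← coeff_zero_eq_constantCoeff_apply, powerQuotCoeff])

theorem powerQuotInv_riccati (v : ℝ) :
    (1 - X) * (powerQuotInv v - X * derivative ℝ (powerQuotInv v)) =
      powerQuotInv v ^ 2 + C v * X * powerQuotInv v := by
  have h := powerQuotInv_mul v
  have hd := congrArg (derivative ℝ) h
  rw [Derivation.leibniz, smul_eq_mul, smul_eq_mul] at hd
  have h1 : derivative ℝ (1 : PowerSeries ℝ) = 0 := Derivation.map_one_eq_zero _
  rw [h1] at hd
  have ho := powerQuot_ode v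
  set f := powerQuotInv v
  set c := powerQuot v
  linear_combination f ^ 2 * ho - (1 - X) * X * f * hd - (1 - X) * f * h
    + (1 - X) * X * (derivative ℝ f) * h + C v * X * f * h

/-- The part of `1 - powerQuotInv v` of order at least two. -/
noncomputable def powerQuotRem (v : ℝ) : PowerSeries ℝ :=
  1 - C ((1 + v) / 2) * X - powerQuotInv v

/-- Removing the linear part of the reciprocal leaves only terms with nonnegative coefficients on
the right when |v| ≤ 1; v enters through the source (1 - v²)/4 alone. -/
theorem powerQuotRem_ode (v : ℝ) :
    X * derivative ℝ (powerQuotRem v) + powerQuotRem v =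
      X * (X * derivative ℝ (powerQuotRem v)) + powerQuotRem v ^ 2
        + C ((1 - v ^ 2) / 4) * X ^ 2 := by
  have h := powerQuotInv_riccati v
  have hf : powerQuotInv v = 1 - C ((1 + v) / 2) * X - powerQuotRem v := by
    rw [powerQuotRem]; ring
  have hd : derivative ℝ (powerQuotInv v) = - C ((1 + v) / 2) - derivative ℝ (powerQuotRem v) := by
    rw [hf]; simp
  rw [hd, hf] at h
  have e1 : (C ((1 - v ^ 2) / 4) : PowerSeries ℝ) =
      C ((1 + v) / 2) * (C ((1 + v) / 2) - C v) := by
    rw [← map_sub, ← map_mul]; congr 1; ring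
  have e2 : (C ((1 + v) / 2) : PowerSeries ℝ) * 2 = 1 + C v := by
    have : (2 : PowerSeries ℝ) = C 2 := (map_ofNat C 2).symm
    rw [this, ← map_mul, ← map_one C, ← map_add]; congr 1; ring
  rw [e1]
  linear_combination h + (X * powerQuotRem v - X) * e2

theorem powerQuotRem_coeff_zero (v : ℝ) : coeff 0 (powerQuotRem v) = 0 := by
  have h := congrArg (coeff 0) (powerQuotInv_mul v)
  simp only [powerQuot, coeff_zero_eq_constantCoeff, map_mul, map_one] at h
  rw [← coeff_zero_eq_constantCoeff_apply (mk _), coeff_mk, powerQuotCoeff_zero, mul_one] at h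
  simp [powerQuotRem, h]

theorem powerQuotRem_coeff_succ (v : ℝ) (k : ℕ) :
    ((k : ℝ) + 2) * coeff (k + 1) (powerQuotRem v) =
      k * coeff k (powerQuotRem v)
        + ∑ p ∈ Finset.HasAntidiagonal.antidiagonal (k + 1), coeff p.1 (powerQuotRem v) * coeff p.2 (powerQuotRem v)
        + if k = 1 then (1 - v ^ 2) / 4 else 0 := by
  have h := congrArg (coeff (k + 1)) (powerQuotRem_ode v)
  rw [map_add, map_add, map_add, coeff_succ_X_mul, coeff_succ_X_mul, coeff_derivative,
    coeff_C_mul, coeff_X_pow, sq, coeff_mul (k + 1)] at h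
  have e : coeff k (X * derivative ℝ (powerQuotRem v)) = k * coeff k (powerQuotRem v) := by
    cases k with
    | zero => simp
    | succ k => rw [coeff_succ_X_mul, coeff_derivative]; push_cast; ring
  rw [e] at h
  have e2 : (k + 1 = 2) = (k = 1) := by simp
  simp only [e2, mul_ite, mul_one, mul_zero] at h
  linear_combination h

theorem powerQuotRem_coeff_one (v : ℝ) : coeff 1 (powerQuotRem v) = 0 := by
  have h := powerQuotRem_coeff_succ v 0
  have h0 := powerQuotRem_coeff_zero v
  rw [zero_add, Finset.Nat.sum_antidiagonal_succ, h0] at h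
  simpa [h0] using h

/-- The end terms vanish with the constant coefficient, so the recursion expresses each coefficient
through strictly earlier ones. -/
theorem sum_antidiagonal_powerQuotRem (v : ℝ) (k : ℕ) :
    ∑ p ∈ Finset.HasAntidiagonal.antidiagonal (k + 2),
      coeff p.1 (powerQuotRem v) * coeff p.2 (powerQuotRem v) =
    ∑ p ∈ Finset.HasAntidiagonal.antidiagonal k,
      coeff (p.1 + 1) (powerQuotRem v) * coeff (p.2 + 1) (powerQuotRem v) := by
  have h0 := powerQuotRem_coeff_zero v
  rw [Finset.Nat.sum_antidiagonal_succ, Finset.Nat.sum_antidiagonal_succ']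
  rw [h0]; simp

theorem powerQuotRem_coeff_nonneg {v : ℝ} (hv : 0 ≤ v) (hv1 : v ≤ 1) (k : ℕ) :
    0 ≤ coeff k (powerQuotRem v) := by
  induction k using Nat.strong_induction_on with
  | _ k ih =>
    match k with
    | 0 => rw [powerQuotRem_coeff_zero]
    | 1 => rw [powerQuotRem_coeff_one]
    | k + 2 =>
      have h := powerQuotRem_coeff_succ v (k + 1)
      rw [sum_antidiagonal_powerQuotRem] at h
      have h1 : 0 ≤ ∑ p ∈ Finset.HasAntidiagonal.antidiagonal k,
          coeff (p.1 + 1) (powerQuotRem v) * coeff (p.2 + 1) (powerQuotRem v) := by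
        refine Finset.sum_nonneg fun p hp => ?_
        have := (Finset.HasAntidiagonal.mem_antidiagonal.mp hp)
        exact mul_nonneg (ih _ (by omega)) (ih _ (by omega))
      have h2 : (0 : ℝ) ≤ if k + 1 = 1 then (1 - v ^ 2) / 4 else 0 := by
        split_ifs
        · nlinarith
        · exact le_rfl
      have h3 : 0 ≤ ((k + 1 : ℕ) : ℝ) * coeff (k + 1) (powerQuotRem v) :=
        mul_nonneg (Nat.cast_nonneg _) (ih _ (by omega))
      have h4 : 0 < ((k + 1 : ℕ) : ℝ) + 2 := by positivity
      exact nonneg_of_mul_nonneg_right (by rw [h]; linarith) h4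

/-- The recursion is monotone in the earlier, nonnegative coefficients, and its source is largest at
v = 0. -/
theorem powerQuotRem_coeff_le {v : ℝ} (hv : 0 ≤ v) (hv1 : v ≤ 1) (k : ℕ) :
    coeff k (powerQuotRem v) ≤ coeff k (powerQuotRem 0) := by
  induction k using Nat.strong_induction_on with
  | _ k ih =>
    match k with
    | 0 => rw [powerQuotRem_coeff_zero, powerQuotRem_coeff_zero]
    | 1 => rw [powerQuotRem_coeff_one, powerQuotRem_coeff_one]
    | k + 2 =>
      have h := powerQuotRem_coeff_succ v (k + 1)
      have h' := powerQuotRem_coeff_succ 0 (k + 1)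
      rw [sum_antidiagonal_powerQuotRem] at h h'
      have h1 : ∑ p ∈ Finset.HasAntidiagonal.antidiagonal k,
          coeff (p.1 + 1) (powerQuotRem v) * coeff (p.2 + 1) (powerQuotRem v) ≤
          ∑ p ∈ Finset.HasAntidiagonal.antidiagonal k,
          coeff (p.1 + 1) (powerQuotRem 0) * coeff (p.2 + 1) (powerQuotRem 0) := by
        refine Finset.sum_le_sum fun p hp => ?_
        have := (Finset.HasAntidiagonal.mem_antidiagonal.mp hp)
        exact mul_le_mul (ih _ (by omega)) (ih _ (by omega))
          (powerQuotRem_coeff_nonneg hv hv1 _)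
          (powerQuotRem_coeff_nonneg le_rfl zero_le_one _)
      have h2 : (if k + 1 = 1 then (1 - v ^ 2) / 4 else 0 : ℝ) ≤
          if k + 1 = 1 then (1 - (0 : ℝ) ^ 2) / 4 else 0 := by
        split_ifs
        · nlinarith
        · exact le_rfl
      have h3 : ((k + 1 : ℕ) : ℝ) * coeff (k + 1) (powerQuotRem v) ≤
          ((k + 1 : ℕ) : ℝ) * coeff (k + 1) (powerQuotRem 0) :=
        mul_le_mul_of_nonneg_left (ih _ (by omega)) (Nat.cast_nonneg _)
      have h4 : 0 < ((k + 1 : ℕ) : ℝ) + 2 := by positivity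
      exact le_of_mul_le_mul_left (by rw [h, h']; linarith) h4

theorem powerQuotInv_coeff_zero (v : ℝ) : coeff 0 (powerQuotInv v) = 1 := by
  have h := powerQuotRem_coeff_zero v
  simp [powerQuotRem] at h ⊢
  linarith

theorem powerQuotInv_coeff_one (v : ℝ) : coeff 1 (powerQuotInv v) = -((1 + v) / 2) := by
  have h := powerQuotRem_coeff_one v
  simp [powerQuotRem, coeff_one] at h ⊢
  linarith

theorem powerQuotInv_coeff_add_two (v : ℝ) (k : ℕ) :
    coeff (k + 2) (powerQuotInv v) = -coeff (k + 2) (powerQuotRem v) := by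
  simp [powerQuotRem, coeff_one]

theorem powerQuotInv_coeff_succ_nonpos {v : ℝ} (hv : 0 ≤ v) (hv1 : v ≤ 1) (k : ℕ) :
    coeff (k + 1) (powerQuotInv v) ≤ 0 := by
  cases k with
  | zero => rw [powerQuotInv_coeff_one]; linarith
  | succ k =>
    rw [powerQuotInv_coeff_add_two]
    linarith [powerQuotRem_coeff_nonneg hv hv1 (k + 2)]

/-- In the product of the two reciprocal series all coefficients of the inverse after the first are
nonpositive, so each is at least minus a coefficient of `powerQuot v`, which is at most 1. -/
theorem abs_powerQuotInv_coeff_le_one {v : ℝ} (hv : 0 ≤ v) (hv1 : v ≤ 1) (k : ℕ) :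
    |coeff k (powerQuotInv v)| ≤ 1 := by
  cases k with
  | zero => simp only [powerQuotInv_coeff_zero, abs_one, le_refl]
  | succ k =>
    have h := congrArg (coeff (k + 1)) (powerQuotInv_mul v)
    rw [coeff_mul, coeff_one, if_neg (Nat.succ_ne_zero k), Finset.Nat.sum_antidiagonal_succ,
      Finset.Nat.sum_antidiagonal_eq_sum_range_succ
        (fun i j => coeff (i + 1) (powerQuotInv v) * coeff j (powerQuot v)),
      Finset.sum_range_succ] at h
    simp only [powerQuotInv_coeff_zero, powerQuot, coeff_mk, Nat.sub_self, powerQuotCoeff_zero,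
      one_mul, mul_one] at h
    have h1 : ∑ i ∈ Finset.range k, coeff (i + 1) (powerQuotInv v) * powerQuotCoeff v (k - i) ≤ 0 :=
      Finset.sum_nonpos fun i _ => mul_nonpos_of_nonpos_of_nonneg
        (powerQuotInv_coeff_succ_nonpos hv hv1 i) (powerQuotCoeff_nonneg hv _)
    have h2 := powerQuotCoeff_le_one hv hv1 (k + 1)
    have h3 := powerQuotInv_coeff_succ_nonpos hv hv1 k
    rw [abs_of_nonpos h3]
    linarith

/-! ### The Gregory-type polynomials and their positivity -/

/-- `(1 / k!) ∑_{l=1}^k B_{l+1} / (l + 1) |s(k, l)| vˡ`, the coefficient of `wᵏ` in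
`1 / (eˣ - 1) - 1 / x + 1 / 2` at `x = -v log (1 - w)`. -/
noncomputable def gregoryPoly (k : ℕ) (v : ℝ) : ℝ :=
  (∑ l ∈ Finset.Icc 1 k,
    (Nat.stirlingFirst k l : ℝ) * ((bernoulli (l + 1) : ℝ) / ((l : ℝ) + 1)) * v ^ l) / (k ! : ℝ)

/-- The power series of `1 / (eˣ - 1) - 1 / x + 1 / 2` at `x = v X`. -/
noncomputable def cothSeries (v : ℝ) : PowerSeries ℝ :=
  PowerSeries.mk fun l => if l = 0 then 0 else (bernoulli (l + 1) : ℝ) / ((l + 1)! : ℝ) * v ^ l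

theorem coeff_stirlingTransform_cothSeries (v : ℝ) (k : ℕ) :
    coeff k (stirlingTransform (cothSeries v)) = gregoryPoly k v := by
  rw [stirlingTransform, gregoryPoly, coeff_mk]
  congr 1
  rw [Finset.sum_range_succ', Finset.range_eq_Ico, Finset.sum_Ico_add'
    (fun l => (Nat.stirlingFirst k l : ℝ) * (l ! : ℝ) * coeff l (cothSeries v)) 0 k 1]
  rw [cothSeries, coeff_mk, if_pos rfl, mul_zero, add_zero, zero_add]
  have : Finset.Ico 1 (k + 1) = Finset.Icc 1 k := rfl
  rw [this]
  refine Finset.sum_congr rfl fun l hl => ?_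
  have hl1 := (Finset.mem_Icc.mp hl).1
  rw [coeff_mk, if_neg (by omega), Nat.factorial_succ]
  have : (l ! : ℝ) ≠ 0 := by positivity
  have : (l : ℝ) + 1 ≠ 0 := by positivity
  push_cast
  field_simp

theorem rescale_bernoulliPowerSeries (v : ℝ) :
    rescale v (bernoulliPowerSeries ℝ) = 1 + C (-v / 2) * X + C v * (X * cothSeries v) := by
  ext k
  rw [coeff_rescale, bernoulliPowerSeries, coeff_mk, map_add, map_add, coeff_C_mul, coeff_C_mul]
  match k with
  | 0 => simp
  | 1 =>
    rw [coeff_succ_X_mul]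
    simp [cothSeries, coeff_one, coeff_one_X, bernoulli_one]
    ring
  | k + 2 =>
    rw [coeff_succ_X_mul, cothSeries, coeff_mk]
    simp [coeff_one, coeff_X]
    ring

theorem stirlingTransform_X : stirlingTransform X = X * powerQuot 0 := by
  ext k
  cases k with
  | zero => simp [stirlingTransform.coeff_zero']
  | succ k =>
    rw [coeff_succ_X_mul, powerQuot, coeff_mk, powerQuotCoeff_at_zero, stirlingTransform, coeff_mk]
    rw [Finset.sum_eq_single 1]
    · rw [coeff_one_X, Nat.stirlingFirst_one_right, Nat.factorial_one, Nat.factorial_succ]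
      have : (k ! : ℝ) ≠ 0 := by positivity
      have : (k : ℝ) + 1 ≠ 0 := by positivity
      push_cast
      field_simp
    · intro l _ hl
      rw [coeff_X, if_neg hl, mul_zero]
    · intro h; simp at h

/-- The formal version of exp(-v log(1 - w)) = (1 - w)⁻ᵛ, with binomial coefficients given by rising
factorials. -/
theorem stirlingTransform_rescale_exp (v : ℝ) :
    stirlingTransform (rescale v (exp ℝ)) = 1 + C v * (X * powerQuot v) := by
  ext k
  have h : coeff k (stirlingTransform (rescale v (exp ℝ))) =
      (ascPochhammer ℝ k).eval v / (k ! : ℝ) := by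
    rw [ascPochhammer_eval_eq_stirlingS, stirlingTransform, coeff_mk, Finset.mul_sum]
    congr 1
    refine Finset.sum_congr rfl fun l _ => ?_
    have h : ((-1 : ℝ) ^ k * (-1) ^ l) * ((-1) ^ k * (-1) ^ l) = 1 := by
      rw [← pow_add, ← pow_add]
      exact Even.neg_one_pow ⟨k + l, rfl⟩
    have hl : (l ! : ℝ) ≠ 0 := by positivity
    rw [coeff_rescale, coeff_exp]
    simp only [stirlingS, Int.cast_mul, Int.cast_pow, Int.cast_neg, Int.cast_one,
      Int.cast_natCast, pow_add, map_div₀, map_one, map_natCast]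
    have h2 : (l ! : ℝ) * (v ^ l * (1 / (l ! : ℝ))) = v ^ l := by field_simp
    rw [mul_assoc, h2]
    linear_combination (-(Nat.stirlingFirst k l : ℝ) * v ^ l) * h
  rw [h]
  cases k with
  | zero => simp
  | succ k =>
    rw [ascPochhammer_eval_eq_powerQuotCoeff, map_add, coeff_C_mul, coeff_succ_X_mul, powerQuot,
      coeff_mk, coeff_one, if_neg (Nat.succ_ne_zero k), zero_add]

/-- With L = -log(1 - w) = w · `powerQuot 0`, the series x/(eˣ - 1) at x = vL equals `powerQuotInv
v` / `powerQuotInv 0`; it also equals 1 - vL/2 + vL times the transformed series. Multiply by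
`powerQuotInv 0`. -/
theorem stirlingTransform_coth_identity {v : ℝ} (hv : v ≠ 0) :
    C v * (X * stirlingTransform (cothSeries v)) =
      powerQuotInv v - powerQuotInv 0 + C (v / 2) * X := by
  have h := congrArg (rescale v) (bernoulliPowerSeries_mul_exp_sub_one ℝ)
  rw [map_mul, map_sub, map_one, rescale_X, rescale_bernoulliPowerSeries] at h
  have h2 : (1 + C (-v / 2) * X + C v * (X * cothSeries v)) * rescale v (exp ℝ) =
      (1 + C (-v / 2) * X + C v * (X * cothSeries v)) + C v * X := by
    linear_combination h
  replace h2 := congrArg stirlingTransform h2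
  simp only [stirlingTransform.map_mul', stirlingTransform.map_add', stirlingTransform.map_C',
    stirlingTransform.map_one', stirlingTransform_rescale_exp, stirlingTransform_X] at h2
  have hne : (C v * X : PowerSeries ℝ) ≠ 0 :=
    mul_ne_zero (by simpa using hv) X_ne_zero
  have h3 := powerQuotInv_mul v
  have h4 := powerQuotInv_mul 0
  rw [neg_div, map_neg] at h2
  have h5 : (1 - C (v / 2) * (X * powerQuot 0) + C v * (X * powerQuot 0 *
      stirlingTransform (cothSeries v))) * powerQuot v = powerQuot 0 := by
    refine mul_left_cancel₀ hne ?_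
    linear_combination h2
  set a := powerQuotInv v
  set b := powerQuotInv 0
  set c := powerQuot v
  set d := powerQuot 0
  set e := stirlingTransform (cothSeries v)
  linear_combination a * b * h5 - b * (1 - C (v / 2) * (X * d) + C v * (X * d * e)) * h3
    + (C (v / 2) * X - C v * (X * e)) * h4 + a * h4

theorem mul_gregoryPoly {v : ℝ} (hv : v ≠ 0) (k : ℕ) (hk : 1 ≤ k) :
    v * gregoryPoly k v = coeff (k + 1) (powerQuotRem 0) - coeff (k + 1) (powerQuotRem v) := by
  obtain ⟨k, rfl⟩ : ∃ j, k = j + 1 := ⟨k - 1, by omega⟩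
  have h := congrArg (coeff (k + 2)) (stirlingTransform_coth_identity hv)
  rw [coeff_C_mul, coeff_succ_X_mul, coeff_stirlingTransform_cothSeries, map_add, map_sub,
    coeff_C_mul, coeff_X, if_neg (by omega), powerQuotInv_coeff_add_two,
    powerQuotInv_coeff_add_two] at h
  rw [h]; ring

theorem gregoryPoly_zero (v : ℝ) : gregoryPoly 0 v = 0 := by simp [gregoryPoly]

theorem gregoryPoly_nonneg {v : ℝ} (hv : 0 < v) (hv1 : v ≤ 1) (k : ℕ) : 0 ≤ gregoryPoly k v := by
  cases k with
  | zero => rw [gregoryPoly_zero]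
  | succ k =>
    have h := mul_gregoryPoly hv.ne' (k + 1) (by omega)
    have h2 := powerQuotRem_coeff_le hv.le hv1 (k + 1 + 1)
    exact nonneg_of_mul_nonneg_right (by rw [h]; linarith) hv

end

/-! ### Summing the power series at w = 1 - e^{-t} -/

section
open PowerSeries

theorem hasSum_ascPochhammer_mul_pow (v : ℝ) {w : ℝ} (hw : |w| < 1) :
    HasSum (fun n : ℕ => (ascPochhammer ℝ n).eval v / (n ! : ℝ) * w ^ n) (1 / (1 - w) ^ v) := by
  have h := (Real.one_div_one_sub_rpow_hasFPowerSeriesOnBall_zero v).hasSum (y := w)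
    (by simpa [Metric.mem_eball, edist_zero_right, ← ofReal_norm] using hw)
  rw [zero_add] at h
  refine h.congr_fun fun n => ?_
  rw [FormalMultilinearSeries.ofScalars_apply_eq, smul_eq_mul]
  congr 1
  have h2 := Ring.factorial_nsmul_multichoose_eq_ascPochhammer v n
  have e : v + n - 1 - n + 1 = v := by ring
  rw [nsmul_eq_mul, Polynomial.ascPochhammer_smeval_eq_eval] at h2
  rw [Ring.choose, e, div_eq_iff (by positivity), mul_comm, h2]

theorem hasSum_powerQuotCoeff {v w : ℝ} (hv : v ≠ 0) (hw0 : w ≠ 0) (hw : |w| < 1) :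
    HasSum (fun k : ℕ => powerQuotCoeff v k * w ^ k) ((1 / (1 - w) ^ v - 1) / (v * w)) := by
  have h := (hasSum_nat_add_iff' 1).mpr (hasSum_ascPochhammer_mul_pow v hw)
  simp only [Finset.sum_range_one, ascPochhammer_zero, Polynomial.eval_one, Nat.factorial_zero,
    Nat.cast_one, div_one, pow_zero, mul_one] at h
  refine (h.div_const (v * w)).congr_fun ?_
  intro k
  rw [ascPochhammer_eval_eq_powerQuotCoeff, pow_succ]
  field_simp

theorem hasSum_powerQuotCoeff_zero {w : ℝ} (hw0 : w ≠ 0) (hw : |w| < 1) :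
    HasSum (fun k : ℕ => powerQuotCoeff 0 k * w ^ k) (-Real.log (1 - w) / w) := by
  refine ((Real.hasSum_pow_div_log_of_abs_lt_one hw).div_const w).congr_fun ?_
  intro k
  rw [powerQuotCoeff_at_zero, pow_succ]
  field_simp

theorem summable_mul_pow_of_abs_le_one {a : ℕ → ℝ} (ha : ∀ k, |a k| ≤ 1) {w : ℝ} (hw0 : 0 ≤ w)
    (hw : w < 1) : Summable fun k => ‖a k * w ^ k‖ := by
  refine Summable.of_nonneg_of_le (fun k => norm_nonneg _) (fun k => ?_)
    (summable_geometric_of_lt_one hw0 hw)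
  rw [norm_mul, Real.norm_eq_abs, Real.norm_eq_abs, abs_of_nonneg (pow_nonneg hw0 k)]
  exact mul_le_of_le_one_left (pow_nonneg hw0 k) (ha k)

/-- A Cauchy product: both coefficient sequences are bounded by 1, so both series converge
absolutely for 0 ≤ w < 1. -/
theorem hasSum_powerQuotInv {v w S : ℝ} (hv : 0 ≤ v) (hv1 : v ≤ 1) (hw0 : 0 ≤ w) (hw : w < 1)
    (hS : HasSum (fun k : ℕ => powerQuotCoeff v k * w ^ k) S) :
    HasSum (fun k : ℕ => coeff k (powerQuotInv v) * w ^ k) S⁻¹ := by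
  have h1 := summable_mul_pow_of_abs_le_one (a := fun k => coeff k (powerQuotInv v))
    (abs_powerQuotInv_coeff_le_one hv hv1) hw0 hw
  have h2 := summable_mul_pow_of_abs_le_one (a := powerQuotCoeff v) (fun k => by
    rw [abs_of_nonneg (powerQuotCoeff_nonneg hv k)]; exact powerQuotCoeff_le_one hv hv1 k) hw0 hw
  have h := tsum_mul_tsum_eq_tsum_sum_antidiagonal_of_summable_norm h1 h2
  rw [hS.tsum_eq] at h
  have h3 : ∀ n, ∑ p ∈ Finset.HasAntidiagonal.antidiagonal n, coeff p.1 (powerQuotInv v) * w ^ p.1 *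
      (powerQuotCoeff v p.2 * w ^ p.2) = if n = 0 then 1 else 0 := by
    intro n
    have h4 := congrArg (coeff n) (powerQuotInv_mul v)
    rw [coeff_mul, coeff_one] at h4
    have : ∑ p ∈ Finset.HasAntidiagonal.antidiagonal n, coeff p.1 (powerQuotInv v) * w ^ p.1 *
      (powerQuotCoeff v p.2 * w ^ p.2) = (∑ p ∈ Finset.HasAntidiagonal.antidiagonal n,
        coeff p.1 (powerQuotInv v) * coeff p.2 (powerQuot v)) * w ^ n := by
      rw [Finset.sum_mul]
      refine Finset.sum_congr rfl fun p hp => ?_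
      rw [← Finset.HasAntidiagonal.mem_antidiagonal.mp hp, pow_add, powerQuot, coeff_mk]
      ring
    rw [this, h4]
    split_ifs with hn
    · simp [hn]
    · simp
  simp only [h3, tsum_ite_eq] at h
  rw [← eq_inv_of_mul_eq_one_left h]
  exact h1.of_norm.hasSum

theorem hasSum_gregoryPoly {v t : ℝ} (hv : 0 < v) (hv1 : v ≤ 1) (ht : 0 < t) :
    HasSum (fun k : ℕ => gregoryPoly k v * (1 - Real.exp (-t)) ^ k)
      (1 / 2 - (1 / (v * t) - 1 / (Real.exp (v * t) - 1))) := by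
  set w := 1 - Real.exp (-t) with hwdef
  have he : Real.exp (-t) < 1 := by rw [Real.exp_lt_one_iff]; linarith
  have hw0 : 0 < w := by linarith
  have hw1 : w < 1 := by have := Real.exp_pos (-t); linarith
  have habs : |w| < 1 := by rw [abs_of_pos hw0]; exact hw1
  have hlog : -Real.log (1 - w) = t := by rw [hwdef]; simp
  have hpow : 1 / (1 - w) ^ v = Real.exp (v * t) := by
    rw [hwdef, sub_sub_cancel, ← Real.exp_mul, one_div, ← Real.exp_neg]; congr 1; ring
  have h1 := hasSum_powerQuotInv hv.le hv1 hw0.le hw1 (hasSum_powerQuotCoeff hv.ne' hw0.ne' habs)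
  have h0 := hasSum_powerQuotInv le_rfl zero_le_one hw0.le hw1
    (hasSum_powerQuotCoeff_zero hw0.ne' habs)
  rw [hlog] at h0
  rw [hpow] at h1
  replace h1 := (hasSum_nat_add_iff' 1).mpr h1
  replace h0 := (hasSum_nat_add_iff' 1).mpr h0
  rw [Finset.sum_range_one, powerQuotInv_coeff_zero, pow_zero, mul_one] at h0 h1
  -- After the constant terms are dropped, the linear term of the identity sits at index 0.
  have h2 : HasSum (fun k : ℕ => if k = 0 then v / 2 * w else 0) (v / 2 * w) := hasSum_ite_eq 0 _
  have h3 := (((h1.sub h0).add h2).div_const (v * w))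
  have hexp : Real.exp (v * t) - 1 ≠ 0 := by
    have : 0 < v * t := by positivity
    have := Real.add_one_lt_exp this.ne'
    linarith
  convert! h3 using 1
  · funext k
    have h := congrArg (coeff (k + 1)) (stirlingTransform_coth_identity hv.ne')
    rw [coeff_C_mul, coeff_succ_X_mul, coeff_stirlingTransform_cothSeries, map_add, map_sub,
      coeff_C_mul, coeff_X] at h
    rw [eq_div_iff (by positivity)]
    have e : gregoryPoly k v * w ^ k * (v * w) = (v * gregoryPoly k v) * w ^ (k + 1) := by ring
    rw [e, h]
    rcases Nat.eq_zero_or_pos k with rfl | hk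
    · simp; ring
    · rw [if_neg (by omega), if_neg (by omega)]; ring
  · field_simp
    ring

/-- By positivity a finite partial sum is at most the full value, itself at most 1/2; then t → ∞
sends w to 1. -/
theorem sum_gregoryPoly_le {v : ℝ} (hv : 0 < v) (hv1 : v ≤ 1) (s : Finset ℕ) :
    ∑ k ∈ s, gregoryPoly k v ≤ 1 / 2 := by
  have h : ∀ t : ℝ, 0 < t → ∑ k ∈ s, gregoryPoly k v * (1 - Real.exp (-t)) ^ k ≤ 1 / 2 := by
    intro t ht
    have he : Real.exp (-t) < 1 := by rw [Real.exp_lt_one_iff]; linarith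
    refine (sum_le_hasSum s (fun k _ => ?_) (hasSum_gregoryPoly hv hv1 ht)).trans ?_
    · exact mul_nonneg (gregoryPoly_nonneg hv hv1 k) (pow_nonneg (by linarith) k)
    · have h0 : 0 < v * t := by positivity
      have h1 := Real.add_one_le_exp (v * t)
      have h2 : 1 / (Real.exp (v * t) - 1) ≤ 1 / (v * t) :=
        one_div_le_one_div_of_le h0 (by linarith)
      linarith
  have hlim : Filter.Tendsto (fun t : ℝ => ∑ k ∈ s, gregoryPoly k v * (1 - Real.exp (-t)) ^ k)
      Filter.atTop (nhds (∑ k ∈ s, gregoryPoly k v * (1 - 0) ^ k)) := by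
    refine tendsto_finsetSum _ fun k _ => ?_
    exact ((tendsto_const_nhds.sub Real.tendsto_exp_neg_atTop_nhds_zero).pow k).const_mul _
  simp only [sub_zero, one_pow, mul_one] at hlim
  exact le_of_tendsto hlim (Filter.eventually_atTop.mpr ⟨1, fun t ht => h t (by linarith)⟩)

end

/-! ### Averaging over v = 1/(1 + y²) -/

section
open MeasureTheory Set Filter Topology Real

theorem integrable_inv_one_add_sq_pow (l : ℕ) :
    Integrable fun y : ℝ => ((1 + y ^ 2)⁻¹) ^ (l + 1) := by
  refine integrable_inv_one_add_sq.mono' (by fun_prop) (ae_of_all _ fun y => ?_)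
  have h0 : 0 ≤ (1 + y ^ 2)⁻¹ := by positivity
  have h1 : (1 + y ^ 2)⁻¹ ≤ 1 := inv_le_one_of_one_le₀ (by nlinarith)
  rw [norm_of_nonneg (by positivity)]
  exact pow_le_of_le_one h0 h1 (by omega)

/-- The derivative of y (1 + y²)^{-(l+1)} integrates to zero over the line. -/
theorem integral_inv_one_add_sq_pow_succ (l : ℕ) :
    (2 * ((l : ℝ) + 1)) * ∫ y : ℝ, ((1 + y ^ 2)⁻¹) ^ (l + 2) =
      (2 * (l : ℝ) + 1) * ∫ y : ℝ, ((1 + y ^ 2)⁻¹) ^ (l + 1) := by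
  have hderiv : ∀ y : ℝ, HasDerivAt (fun y : ℝ => y * ((1 + y ^ 2)⁻¹) ^ (l + 1))
      (2 * ((l : ℝ) + 1) * ((1 + y ^ 2)⁻¹) ^ (l + 2)
        - (2 * (l : ℝ) + 1) * ((1 + y ^ 2)⁻¹) ^ (l + 1)) y := by
    intro y
    have hne : 1 + y ^ 2 ≠ 0 := by positivity
    have h1 : HasDerivAt (fun y : ℝ => 1 + y ^ 2) (2 * y) y := by
      simpa using (hasDerivAt_pow 2 y).const_add 1
    have h2 := (hasDerivAt_id y).mul ((h1.inv hne).pow (l + 1))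
    convert! h2 using 1
    simp only [id, Pi.pow_apply, Pi.inv_apply, Nat.add_sub_cancel]
    push_cast
    have hq : y ^ 2 * (1 + y ^ 2)⁻¹ = 1 - (1 + y ^ 2)⁻¹ := by field_simp; ring
    rw [div_eq_mul_inv, ← inv_pow]
    set q := (1 + y ^ 2)⁻¹
    linear_combination (2 * ((l : ℝ) + 1) * q ^ (l + 1)) * hq
  -- At y = 0 both sides are 0, as `0⁻¹ = 0`.
  have hbound : ∀ y : ℝ, ‖y * ((1 + y ^ 2)⁻¹) ^ (l + 1)‖ ≤ ‖y⁻¹‖ := by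
    intro y
    rcases eq_or_ne y 0 with rfl | hy
    · simp
    have h0 : 0 ≤ (1 + y ^ 2)⁻¹ := by positivity
    have h1 : (1 + y ^ 2)⁻¹ ≤ 1 := inv_le_one_of_one_le₀ (by nlinarith)
    have h2 : ((1 + y ^ 2)⁻¹) ^ (l + 1) ≤ (1 + y ^ 2)⁻¹ := pow_le_of_le_one h0 h1 (by omega)
    rw [norm_mul, norm_of_nonneg (pow_nonneg h0 (l + 1)), norm_inv]
    have hy' : 0 < ‖y‖ := norm_pos_iff.mpr hy
    rw [le_inv_comm₀ (by positivity) hy', mul_inv]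
    have h3 : (1 + y ^ 2) ≤ (((1 + y ^ 2)⁻¹) ^ (l + 1))⁻¹ := by
      rw [le_inv_comm₀ (by positivity) (by positivity)]; exact h2
    refine le_trans ?_ (mul_le_mul_of_nonneg_left h3 (by positivity))
    rw [le_inv_mul_iff₀ hy', ← sq, norm_eq_abs, sq_abs]
    linarith
  have hb := integral_of_hasDerivAt_of_tendsto hderiv
    (((integrable_inv_one_add_sq_pow (l + 1)).const_mul _).sub
      ((integrable_inv_one_add_sq_pow l).const_mul _))
    (squeeze_zero_norm hbound (by simpa using (tendsto_inv_atBot_zero (𝕜 := ℝ)).norm))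
    (squeeze_zero_norm hbound (by simpa using (tendsto_inv_atTop_zero (𝕜 := ℝ)).norm))
  rw [integral_sub ((integrable_inv_one_add_sq_pow (l + 1)).const_mul _)
    ((integrable_inv_one_add_sq_pow l).const_mul _), integral_const_mul, integral_const_mul] at hb
  linarith

theorem integral_inv_one_add_sq_pow (l : ℕ) :
    ∫ y : ℝ, ((1 + y ^ 2)⁻¹) ^ (l + 1) = π * (((2 * l - 1)‼ : ℝ) / (2 ^ l * (l ! : ℝ))) := by
  induction l with
  | zero => simp [integral_univ_inv_one_add_sq]
  | succ l ih =>
    have h := integral_inv_one_add_sq_pow_succ l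
    rw [ih] at h
    have hl : (l : ℝ) + 1 ≠ 0 := by positivity
    have hl' : (l ! : ℝ) ≠ 0 := by positivity
    -- At l = 0 the truncated `2 * 0 - 1` is 0, and `0‼ = 1` plays the role of (-1)!!.
    have hd : (2 * (l + 1) - 1)‼ = (2 * l + 1) * (2 * l - 1)‼ := by
      cases l with
      | zero => rfl
      | succ l =>
        rw [show 2 * (l + 1 + 1) - 1 = (2 * l + 1) + 2 by omega,
          show 2 * (l + 1) - 1 = 2 * l + 1 by omega, Nat.doubleFactorial_add_two]
        ring
    refine mul_left_cancel₀ (mul_ne_zero two_ne_zero hl) (h.trans ?_)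
    rw [hd, Nat.factorial_succ, pow_succ]
    push_cast
    field_simp

/-- The nonnegative numbers `-invSqrtCoeff₁ k / k!`. -/
noncomputable def invSqrtWeight (k : ℕ) : ℝ := -(invSqrtCoeff₁ k : ℝ) / (k ! : ℝ)

theorem neg_invSqrtCoeff₁ (k : ℕ) :
    -(invSqrtCoeff₁ k : ℝ) = ∑ l ∈ Finset.Icc 1 k, (((2 * l - 1)‼ : ℝ) / (2 ^ l * ((l + 1)! : ℝ)))
      * (bernoulli (l + 1) : ℝ) * (Nat.stirlingFirst k l : ℝ) := by
  rw [invSqrtCoeff₁]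
  push_cast [stirlingS]
  rw [Finset.mul_sum, ← Finset.sum_neg_distrib]
  refine Finset.sum_congr rfl fun l _ => ?_
  have h : ((-1 : ℝ) ^ k * (-1) ^ l) * ((-1) ^ k * (-1) ^ l) = 1 := by
    rw [← pow_add, ← pow_add]
    exact Even.neg_one_pow ⟨k + l, rfl⟩
  rw [pow_succ, pow_add]
  set a := ((2 * l - 1)‼ : ℝ) / (2 ^ l * ((l + 1)! : ℝ))
  linear_combination (a * (bernoulli (l + 1) : ℝ) * (Nat.stirlingFirst k l : ℝ)) * h

theorem gregoryPoly_mul_self (k : ℕ) (v : ℝ) : gregoryPoly k v * v =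
    ∑ l ∈ Finset.Icc 1 k, ((Nat.stirlingFirst k l : ℝ) *
      ((bernoulli (l + 1) : ℝ) / ((l : ℝ) + 1)) / (k ! : ℝ)) * v ^ (l + 1) := by
  rw [gregoryPoly, Finset.sum_div, Finset.sum_mul]
  exact Finset.sum_congr rfl fun l _ => by ring

theorem integrable_gregoryPoly (k : ℕ) :
    Integrable fun y : ℝ => gregoryPoly k (1 + y ^ 2)⁻¹ * (1 + y ^ 2)⁻¹ := by
  simp only [gregoryPoly_mul_self]
  exact integrable_finsetSum _ fun l _ => (integrable_inv_one_add_sq_pow l).const_mul _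

theorem integral_gregoryPoly (k : ℕ) :
    ∫ y : ℝ, gregoryPoly k (1 + y ^ 2)⁻¹ * (1 + y ^ 2)⁻¹ = π * invSqrtWeight k := by
  simp only [gregoryPoly_mul_self]
  rw [integral_finsetSum _ fun l _ => (integrable_inv_one_add_sq_pow l).const_mul _,
    invSqrtWeight, neg_invSqrtCoeff₁, Finset.sum_div, Finset.mul_sum]
  refine Finset.sum_congr rfl fun l _ => ?_
  rw [integral_const_mul, integral_inv_one_add_sq_pow, Nat.factorial_succ]
  have hl : (l : ℝ) + 1 ≠ 0 := by positivity
  have hl' : (l ! : ℝ) ≠ 0 := by positivity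
  have hk : (k ! : ℝ) ≠ 0 := by positivity
  push_cast
  field_simp

theorem inv_one_add_sq_mem (y : ℝ) : 0 < (1 + y ^ 2)⁻¹ ∧ (1 + y ^ 2)⁻¹ ≤ 1 :=
  ⟨by positivity, inv_le_one_of_one_le₀ (by nlinarith)⟩

theorem invSqrtWeight_nonneg (k : ℕ) : 0 ≤ invSqrtWeight k := by
  have h : 0 ≤ π * invSqrtWeight k := by
    rw [← integral_gregoryPoly]
    refine integral_nonneg fun y => ?_
    obtain ⟨h0, h1⟩ := inv_one_add_sq_mem y
    exact mul_nonneg (gregoryPoly_nonneg h0 h1 k) h0.le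
  exact nonneg_of_mul_nonneg_right h pi_pos

/-- The weights are averages of `gregoryPoly` against the Cauchy density of total mass π, so the
pointwise bound 1/2 survives. -/
theorem sum_invSqrtWeight_le (s : Finset ℕ) : ∑ k ∈ s, invSqrtWeight k ≤ 1 / 2 := by
  have h : π * ∑ k ∈ s, invSqrtWeight k ≤ π * (1 / 2) := by
    rw [Finset.mul_sum]
    simp only [← integral_gregoryPoly]
    rw [← integral_finsetSum _ fun k _ => integrable_gregoryPoly k,
      ← integral_univ_inv_one_add_sq, ← integral_mul_const]
    refine integral_mono (integrable_finsetSum _ fun k _ => integrable_gregoryPoly k)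
      (integrable_inv_one_add_sq.mul_const _) fun y => ?_
    obtain ⟨h0, h1⟩ := inv_one_add_sq_mem y
    simp only [← Finset.sum_mul]
    rw [mul_comm]
    exact mul_le_mul_of_nonneg_left (sum_gregoryPoly_le h0 h1 s) h0.le
  exact le_of_mul_le_mul_left h pi_pos

theorem summable_invSqrtWeight : Summable invSqrtWeight :=
  summable_of_sum_le invSqrtWeight_nonneg sum_invSqrtWeight_le

/-! ### Rising products and Laplace transforms -/

theorem shiftedRising_succ (n k : ℕ) :
    shiftedRising n (k + 1) = shiftedRising n k * ((n : ℝ) + k + 1) := by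
  rw [shiftedRising, Finset.prod_Icc_succ_top (by omega), ← shiftedRising]
  push_cast
  ring

theorem shiftedRising_zero (n : ℕ) : shiftedRising n 0 = 1 := by simp [shiftedRising]

theorem shiftedRising_pos (n k : ℕ) : 0 < shiftedRising n k :=
  Finset.prod_pos fun j hj => by
    have := (Finset.mem_Icc.mp hj).1
    have : (0 : ℝ) < j := by exact_mod_cast this
    positivity

theorem succ_mul_shiftedRising_succ (n k : ℕ) :
    ((n : ℝ) + 1) * shiftedRising (n + 1) k = shiftedRising n (k + 1) := by
  induction k with
  | zero => rw [shiftedRising_succ, shiftedRising_zero, shiftedRising_zero]; simp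
  | succ k ih =>
    rw [shiftedRising_succ, shiftedRising_succ n (k + 1), ← ih]
    push_cast
    ring

theorem factorial_le_shiftedRising (n k : ℕ) : (k ! : ℝ) ≤ shiftedRising n k := by
  induction k with
  | zero => simp [shiftedRising_zero]
  | succ k ih =>
    rw [shiftedRising_succ, Nat.factorial_succ, mul_comm]
    push_cast
    refine mul_le_mul ih ?_ (by positivity) (shiftedRising_pos n k).le
    have : (0 : ℝ) ≤ n := Nat.cast_nonneg n
    linarith

/-- A Beta integral. Splitting off one factor 1 - e^{-t} gives the difference of the cases n and n +
1 for the previous power. -/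
theorem laplace_one_sub_exp_pow (n k : ℕ) (hn : 1 ≤ n) :
    IntegrableOn (fun t : ℝ => exp (-n * t) * (1 - exp (-t)) ^ k) (Ioi 0) ∧
    ∫ t in Ioi (0 : ℝ), exp (-n * t) * (1 - exp (-t)) ^ k = (k ! : ℝ) / (n * shiftedRising n k) := by
  induction k generalizing n with
  | zero =>
    have hn' : (0 : ℝ) < n := by exact_mod_cast hn
    simp only [pow_zero, mul_one, shiftedRising_zero, Nat.factorial_zero, Nat.cast_one]
    refine ⟨exp_neg_integrableOn_Ioi 0 hn', ?_⟩
    rw [integral_exp_mul_Ioi (by linarith)]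
    simp
  | succ k ih =>
    have hn' : (0 : ℝ) < n := by exact_mod_cast hn
    obtain ⟨hi1, he1⟩ := ih n hn
    obtain ⟨hi2, he2⟩ := ih (n + 1) (by omega)
    have e : (fun t : ℝ => exp (-n * t) * (1 - exp (-t)) ^ (k + 1)) = fun t : ℝ =>
        exp (-n * t) * (1 - exp (-t)) ^ k - exp (-(n + 1 : ℕ) * t) * (1 - exp (-t)) ^ k := by
      funext t
      have : exp (-(n + 1 : ℕ) * t) = exp (-n * t) * exp (-t) := by
        rw [← exp_add]; congr 1; push_cast; ring
      rw [this, pow_succ]; ring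
    rw [e]
    refine ⟨hi1.sub hi2, ?_⟩
    rw [integral_sub hi1 hi2, he1, he2]
    push_cast
    rw [succ_mul_shiftedRising_succ, shiftedRising_succ, Nat.factorial_succ]
    have := (shiftedRising_pos n k).ne'
    have : (n : ℝ) + k + 1 ≠ 0 := by positivity
    push_cast
    field_simp
    ring

/-- The function `1 / u - 1 / (eᵘ - 1)`. -/
noncomputable def bernoulliGap (u : ℝ) : ℝ := 1 / u - 1 / (exp u - 1)

theorem bernoulliGap_nonneg {u : ℝ} (hu : 0 < u) : 0 ≤ bernoulliGap u := by
  have h1 := add_one_le_exp u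
  exact sub_nonneg.mpr (one_div_le_one_div_of_le hu (by linarith))

/-- At v = 1 the difference 1/2 - g(u) is a series of nonnegative terms. -/
theorem bernoulliGap_le {u : ℝ} (hu : 0 < u) : bernoulliGap u ≤ 1 / 2 := by
  have h := hasSum_gregoryPoly one_pos le_rfl hu
  have he : exp (-u) < 1 := by rw [exp_lt_one_iff]; linarith
  have h2 := h.nonneg fun k => mul_nonneg (gregoryPoly_nonneg one_pos le_rfl k)
    (pow_nonneg (by linarith) k)
  rw [one_mul] at h2
  rw [bernoulliGap]
  linarith

theorem measurable_bernoulliGap : Measurable bernoulliGap := by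
  unfold bernoulliGap
  fun_prop

/-- Termwise integration against e^{-nt}: the terms are nonnegative, and their integrals are
dominated by `gregoryPoly k v`, which is summable. -/
theorem hasSum_laplace_bernoulliGap {v : ℝ} (hv : 0 < v) (hv1 : v ≤ 1) (n : ℕ) (hn : 1 ≤ n) :
    HasSum (fun k => gregoryPoly k v * ((k ! : ℝ) / (n * shiftedRising n k)))
      (1 / (2 * n) - ∫ t in Ioi (0 : ℝ), exp (-n * t) * bernoulliGap (v * t)) := by
  have hn' : (0 : ℝ) < n := by exact_mod_cast hn
  have hF : ∀ k, ∫ t in Ioi (0 : ℝ), gregoryPoly k v * (exp (-n * t) * (1 - exp (-t)) ^ k) =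
      gregoryPoly k v * ((k ! : ℝ) / (n * shiftedRising n k)) := fun k => by
    rw [integral_const_mul, (laplace_one_sub_exp_pow n k hn).2]
  have hnorm : ∀ k, ∫ t in Ioi (0 : ℝ), ‖gregoryPoly k v * (exp (-n * t) * (1 - exp (-t)) ^ k)‖ =
      gregoryPoly k v * ((k ! : ℝ) / (n * shiftedRising n k)) := fun k => by
    rw [← hF]
    refine setIntegral_congr_fun measurableSet_Ioi fun t ht => ?_
    have he : exp (-t) < 1 := by rw [exp_lt_one_iff]; linarith [mem_Ioi.mp ht]
    exact norm_of_nonneg (mul_nonneg (gregoryPoly_nonneg hv hv1 k)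
      (mul_nonneg (exp_pos _).le (pow_nonneg (by linarith) k)))
  have hsum : Summable fun k => gregoryPoly k v * ((k ! : ℝ) / (n * shiftedRising n k)) := by
    have hg : Summable fun k => gregoryPoly k v :=
      summable_of_sum_le (gregoryPoly_nonneg hv hv1) (sum_gregoryPoly_le hv hv1)
    refine Summable.of_nonneg_of_le (fun k => mul_nonneg (gregoryPoly_nonneg hv hv1 k) ?_)
      (fun k => mul_le_of_le_one_right (gregoryPoly_nonneg hv hv1 k) ?_) hg
    · have := shiftedRising_pos n k; positivity
    · have := shiftedRising_pos n k
      rw [div_le_one (by positivity)]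
      have h1 : (1 : ℝ) ≤ n := by exact_mod_cast hn
      nlinarith [factorial_le_shiftedRising n k]
  have h := hasSum_integral_of_summable_integral_norm
    (F := fun k t => gregoryPoly k v * (exp (-n * t) * (1 - exp (-t)) ^ k))
    (μ := volume.restrict (Ioi 0))
    (fun k => (laplace_one_sub_exp_pow n k hn).1.const_mul _) (by simpa only [hnorm] using hsum)
  simp only [hF] at h
  convert! h using 1
  have hexp : IntegrableOn (fun t : ℝ => exp (-n * t)) (Ioi 0) := exp_neg_integrableOn_Ioi 0 hn'
  have hgap : IntegrableOn (fun t : ℝ => exp (-n * t) * bernoulliGap (v * t)) (Ioi 0) := by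
    refine hexp.mono' ?_ ?_
    · have := measurable_bernoulliGap
      exact (by fun_prop : Measurable fun t : ℝ => exp (-n * t) *
        bernoulliGap (v * t)).aestronglyMeasurable
    · refine (ae_restrict_iff' measurableSet_Ioi).mpr (ae_of_all _ fun t ht => ?_)
      have hvt : 0 < v * t := mul_pos hv ht
      rw [norm_of_nonneg (mul_nonneg (exp_pos _).le (bernoulliGap_nonneg hvt))]
      exact mul_le_of_le_one_right (exp_pos _).le ((bernoulliGap_le hvt).trans (by norm_num))
  have h2 : ∫ t in Ioi (0 : ℝ), exp (-n * t) * (1 / 2) = 1 / (2 * n) := by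
    rw [integral_mul_const, integral_exp_mul_Ioi (by linarith)]
    simp
  rw [← h2, ← integral_sub (hexp.mul_const _) hgap]
  refine setIntegral_congr_fun measurableSet_Ioi fun t ht => ?_
  have h3 := (hasSum_gregoryPoly hv hv1 ht).mul_left (exp (-n * t))
  have e : ∀ k, gregoryPoly k v * (exp (-n * t) * (1 - exp (-t)) ^ k) =
    exp (-n * t) * (gregoryPoly k v * (1 - exp (-t)) ^ k) := fun k => by ring
  simp only [e]
  rw [h3.tsum_eq, bernoulliGap]
  ring

end

/-! ### The transform with weight u^{-1/2} and the sum of the weights -/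

section
open MeasureTheory Set Filter Topology Real

theorem integrableOn_exp_div_sqrt {r : ℝ} (hr : 0 < r) :
    IntegrableOn (fun u : ℝ => exp (-r * u) / √u) (Ioi 0) := by
  have h := integrableOn_rpow_mul_exp_neg_mul_rpow (s := -(1 / 2)) (p := 1) (by norm_num) one_pos hr
  refine h.congr_fun (fun u hu => ?_) measurableSet_Ioi
  simp only [rpow_one]
  rw [rpow_neg (le_of_lt hu), ← sqrt_eq_rpow, div_eq_mul_inv, mul_comm]

theorem integral_exp_div_sqrt {r : ℝ} (hr : 0 < r) :
    ∫ u in Ioi (0 : ℝ), exp (-r * u) / √u = √π / √r := by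
  have h := integral_rpow_mul_exp_neg_mul_Ioi (a := 1 / 2) (by norm_num) hr
  rw [Gamma_one_half_eq, ← sqrt_eq_rpow, sqrt_div zero_le_one, sqrt_one, one_div_mul_eq_div] at h
  rw [← h]
  refine setIntegral_congr_fun measurableSet_Ioi fun u hu => ?_
  rw [show (1 / 2 - 1 : ℝ) = -(1 / 2) by norm_num, rpow_neg (le_of_lt hu), ← sqrt_eq_rpow,
    div_eq_mul_inv, mul_comm, neg_mul]

/-- `∫₀^∞ e^{-ru} u^{-1/2} (1/u - 1/(eᵘ - 1)) du`. -/
noncomputable def gapTransform (r : ℝ) : ℝ :=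
  ∫ u in Ioi (0 : ℝ), exp (-r * u) / √u * bernoulliGap u

theorem integrableOn_gapTransform {r : ℝ} (hr : 0 < r) :
    IntegrableOn (fun u : ℝ => exp (-r * u) / √u * bernoulliGap u) (Ioi 0) := by
  refine (integrableOn_exp_div_sqrt hr).mono' ?_ ?_
  · have := measurable_bernoulliGap
    exact (by fun_prop : Measurable fun u : ℝ => exp (-r * u) / √u *
      bernoulliGap u).aestronglyMeasurable
  · refine (ae_restrict_iff' measurableSet_Ioi).mpr (ae_of_all _ fun u hu => ?_)
    rw [norm_of_nonneg (mul_nonneg (by positivity) (bernoulliGap_nonneg hu))]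
    exact mul_le_of_le_one_right (by positivity) ((bernoulliGap_le hu).trans (by norm_num))

/-- The Gaussian integral over y creates the factor u^{-1/2} from the unweighted kernel. -/
theorem integral_gaussian_mul_gap {r u : ℝ} (hr : 0 < r) (hu : 0 < u) :
    ∫ y : ℝ, exp (-(r * (1 + y ^ 2)) * u) * bernoulliGap u =
      √π / √r * (exp (-r * u) / √u * bernoulliGap u) := by
  have e : ∀ y : ℝ, exp (-(r * (1 + y ^ 2)) * u) * bernoulliGap u =
      exp (-(r * u) * y ^ 2) * (exp (-r * u) * bernoulliGap u) := fun y => by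
    rw [← mul_assoc, ← exp_add]; congr 2; ring
  simp only [e]
  rw [integral_mul_const, integral_gaussian, sqrt_div pi_pos.le, sqrt_mul hr.le]
  field_simp

theorem integrable_gaussian_mul_gap {r : ℝ} (hr : 0 < r) :
    Integrable (Function.uncurry fun y u : ℝ => exp (-(r * (1 + y ^ 2)) * u) * bernoulliGap u)
      ((volume : Measure ℝ).prod (volume.restrict (Ioi 0))) := by
  have hm : Measurable (Function.uncurry fun y u : ℝ =>
      exp (-(r * (1 + y ^ 2)) * u) * bernoulliGap u) := by
    have := measurable_bernoulliGap
    unfold Function.uncurry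
    fun_prop
  rw [integrable_prod_iff' hm.aestronglyMeasurable]
  constructor
  · refine (ae_restrict_iff' measurableSet_Ioi).mpr (ae_of_all _ fun u hu => ?_)
    have hu' : 0 < u := hu
    have h := (integrable_exp_neg_mul_sq (mul_pos hr hu')).mul_const
      (exp (-r * u) * bernoulliGap u)
    refine h.congr (ae_of_all _ fun y => ?_)
    simp only [Function.uncurry]
    rw [← mul_assoc, ← exp_add]; congr 2; ring
  · refine ((integrableOn_gapTransform hr).const_mul (√π / √r)).congr ?_
    refine (ae_restrict_iff' measurableSet_Ioi).mpr (ae_of_all _ fun u hu => ?_)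
    simp only [Function.uncurry]
    rw [← integral_gaussian_mul_gap hr hu]
    exact integral_congr_ae (ae_of_all _ fun y =>
      (norm_of_nonneg (mul_nonneg (exp_pos _).le (bernoulliGap_nonneg hu))).symm)

/-- Substitute u = t/a. For a = 1 + y² the Jacobian is the extra factor v carried by the integrals
of `gregoryPoly`. -/
theorem inv_mul_laplace_bernoulliGap (r : ℝ) {a : ℝ} (ha : 0 < a) :
    a⁻¹ * ∫ t in Ioi (0 : ℝ), exp (-r * t) * bernoulliGap (a⁻¹ * t) =
      ∫ u in Ioi (0 : ℝ), exp (-(r * a) * u) * bernoulliGap u := by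
  have h := integral_comp_mul_left_Ioi
    (fun u : ℝ => exp (-(r * a) * u) * bernoulliGap u) 0 (inv_pos.mpr ha)
  rw [mul_zero, inv_inv, smul_eq_mul] at h
  rw [inv_mul_eq_iff_eq_mul₀ ha.ne', ← h]
  refine setIntegral_congr_fun measurableSet_Ioi fun t _ => ?_
  congr 2
  field_simp

theorem hasSum_invSqrtWeight (n : ℕ) (hn : 1 ≤ n) :
    HasSum (fun k => invSqrtWeight k * ((k ! : ℝ) / shiftedRising n k))
      (1 / 2 - √n / √π * gapTransform n) := by
  have hn' : (0 : ℝ) < n := by exact_mod_cast hn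
  have hle : ∀ k, (k ! : ℝ) / (n * shiftedRising n k) ≤ 1 := fun k => by
    have := shiftedRising_pos n k
    rw [div_le_one (by positivity)]
    have h1 : (1 : ℝ) ≤ n := by exact_mod_cast hn
    nlinarith [factorial_le_shiftedRising n k]
  have hnn : ∀ k, 0 ≤ (k ! : ℝ) / (n * shiftedRising n k) := fun k => by
    have := shiftedRising_pos n k; positivity
  set F : ℕ → ℝ → ℝ := fun k y =>
    gregoryPoly k (1 + y ^ 2)⁻¹ * (1 + y ^ 2)⁻¹ * ((k ! : ℝ) / (n * shiftedRising n k)) with hFdef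
  have hF : ∀ k, ∫ y, F k y = π * invSqrtWeight k * ((k ! : ℝ) / (n * shiftedRising n k)) :=
    fun k => by rw [hFdef]; simp only; rw [integral_mul_const, integral_gregoryPoly]
  have hFnn : ∀ k y, 0 ≤ F k y := fun k y => by
    obtain ⟨h0, h1⟩ := inv_one_add_sq_mem y
    exact mul_nonneg (mul_nonneg (gregoryPoly_nonneg h0 h1 k) h0.le) (hnn k)
  have hsum : Summable fun k => ∫ y, ‖F k y‖ := by
    simp only [fun k y => norm_of_nonneg (hFnn k y), hF]
    refine Summable.of_nonneg_of_le (fun k => mul_nonneg (mul_nonneg pi_pos.le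
      (invSqrtWeight_nonneg k)) (hnn k)) (fun k => mul_le_of_le_one_right
      (mul_nonneg pi_pos.le (invSqrtWeight_nonneg k)) (hle k)) (summable_invSqrtWeight.mul_left π)
  have h := hasSum_integral_of_summable_integral_norm (F := F)
    (fun k => (integrable_gregoryPoly k).mul_const _) hsum
  have hInteg := integrable_gaussian_mul_gap hn'
  have hval : ∫ y, ∑' k, F k y = π * (1 / (2 * n)) - √π / √n * gapTransform n := by
    have e : ∀ y, ∑' k, F k y = (1 + y ^ 2)⁻¹ * (1 / (2 * n)) -
        ∫ u in Ioi (0 : ℝ), exp (-(n * (1 + y ^ 2)) * u) * bernoulliGap u := by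
      intro y
      obtain ⟨h0, h1⟩ := inv_one_add_sq_mem y
      have h2 := (hasSum_laplace_bernoulliGap h0 h1 n hn).mul_left (1 + y ^ 2)⁻¹
      rw [mul_sub, inv_mul_laplace_bernoulliGap n (by positivity)] at h2
      rw [← h2.tsum_eq]
      exact tsum_congr fun k => by rw [hFdef]; ring
    simp only [e]
    have hInteg' : Integrable fun y : ℝ =>
        ∫ u in Ioi (0 : ℝ), exp (-(n * (1 + y ^ 2)) * u) * bernoulliGap u := hInteg.integral_prod_left
    rw [integral_sub (integrable_inv_one_add_sq.mul_const _) hInteg',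
      integral_mul_const, integral_univ_inv_one_add_sq]
    congr 1
    rw [integral_integral_swap hInteg, gapTransform, ← integral_const_mul]
    exact setIntegral_congr_fun measurableSet_Ioi fun u hu => integral_gaussian_mul_gap hn' hu
  simp only [hF] at h
  rw [hval] at h
  -- Clears the π of the Cauchy mass and the n of the Laplace transforms.
  have h3 := h.mul_left ((n : ℝ) / π)
  have hs : (√(n : ℝ)) ^ 2 = n := sq_sqrt hn'.le
  have hs' : √π ^ 2 = π := sq_sqrt pi_pos.le
  have hpos : 0 < √(n : ℝ) := sqrt_pos.mpr hn'
  have hpos' : 0 < √π := sqrt_pos.mpr pi_pos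
  convert! h3 using 1
  · funext k
    have := (shiftedRising_pos n k).ne'
    have := pi_pos.ne'
    field_simp
  · have := pi_pos.ne'
    rw [mul_sub]
    congr 1
    · field_simp
    · rw [← mul_assoc]
      congr 1
      rw [div_mul_div_comm, div_eq_div_iff (by positivity) (by positivity)]
      linear_combination π * hs - n * hs'

end

/-! ### The difference equation of the transform -/

section
open MeasureTheory Set Filter Topology Real

/-- Since e^{-ru} - e^{-(r+1)u} = e^{-(r+1)u}(eᵘ - 1), the term 1/(eᵘ - 1) cancels. The remaining
u^{-3/2} is integrated by parts through f, which vanishes at 0 and at infinity, leaving Gamma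
integrals. -/
theorem gapTransform_sub_gapTransform {r : ℝ} (hr : 0 < r) :
    gapTransform r - gapTransform (r + 1) = √π * (2 * √(r + 1) - 2 * √r - 1 / √(r + 1)) := by
  have hr1 : 0 < r + 1 := by linarith
  set f : ℝ → ℝ := fun u => -2 * ((exp (-r * u) - exp (-(r + 1) * u)) / √u) with hf
  set f' : ℝ → ℝ := fun u => (exp (-r * u) / √u * bernoulliGap u
    - exp (-(r + 1) * u) / √u * bernoulliGap u) + (2 * r * (exp (-r * u) / √u)
    - (2 * r + 1) * (exp (-(r + 1) * u) / √u)) with hf'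
  have hfac : ∀ u, exp (-(r + 1) * u) = exp (-r * u) * exp (-u) := fun u => by
    rw [← exp_add]; congr 1; ring
  have hderiv : ∀ u ∈ Ioi (0 : ℝ), HasDerivAt f (f' u) u := by
    intro u hu
    have hu' : 0 < u := hu
    have h1 : ∀ a : ℝ, HasDerivAt (fun u => exp (-a * u)) (exp (-a * u) * (-a)) u := fun a => by
      simpa using ((hasDerivAt_id u).const_mul (-a)).exp
    have hs : √u ≠ 0 := (sqrt_pos.mpr hu').ne'
    have h2 := ((((h1 r).sub (h1 (r + 1))).div (hasDerivAt_sqrt hu'.ne') hs)).const_mul (-2)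
    convert! h2 using 1
    have hE : exp u - 1 ≠ 0 := by linarith [add_one_lt_exp hu'.ne']
    have hsq : √u ^ 2 = u := sq_sqrt hu'.le
    simp only [hf', Pi.sub_apply]
    have e1 : exp (-r * u) = exp (-(r + 1) * u) * exp u := by rw [← exp_add]; congr 1; ring
    rw [bernoulliGap, e1, show 1 / u = 1 / √u ^ 2 by rw [hsq]]
    generalize exp (-(r + 1) * u) = A
    generalize √u = q at hs
    field_simp
    ring
  have hInteg1 := integrableOn_gapTransform hr
  have hInteg2 := integrableOn_gapTransform hr1
  have hInteg3 := (integrableOn_exp_div_sqrt hr).const_mul (2 * r)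
  have hInteg4 := (integrableOn_exp_div_sqrt hr1).const_mul (2 * r + 1)
  have hInteg : IntegrableOn f' (Ioi 0) := (hInteg1.sub hInteg2).add (hInteg3.sub hInteg4)
  -- From 1 - e^{-u} ≤ min(u, 1): the first bound serves at 0, the second at infinity.
  have hfb : ∀ u, 0 ≤ u → ‖f u‖ ≤ 2 * √u ∧ ‖f u‖ ≤ 2 * (√u)⁻¹ := by
    intro u hu
    have h1 : exp (-r * u) ≤ 1 := exp_le_one_iff.mpr (by nlinarith)
    have h2 : exp (-u) ≤ 1 := exp_le_one_iff.mpr (by linarith)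
    have h3 : 1 - u ≤ exp (-u) := by linarith [add_one_le_exp (-u)]
    have h4 := exp_pos (-r * u)
    have h5 := exp_pos (-u)
    have e : f u = -2 * ((exp (-r * u) * (1 - exp (-u))) / √u) := by
      rw [hf]; simp only; rw [hfac]; ring
    have hnn : 0 ≤ (exp (-r * u) * (1 - exp (-u))) / √u :=
      div_nonneg (mul_nonneg h4.le (by linarith)) (sqrt_nonneg _)
    have hn : ‖f u‖ = 2 * ((exp (-r * u) * (1 - exp (-u))) / √u) := by
      rw [e, norm_mul, norm_of_nonneg hnn]; norm_num
    rw [hn]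
    constructor
    · refine mul_le_mul_of_nonneg_left ?_ two_pos.le
      nth_rewrite 2 [← div_sqrt]
      refine div_le_div_of_nonneg_right ?_ (sqrt_nonneg _)
      nlinarith
    · refine mul_le_mul_of_nonneg_left ?_ two_pos.le
      rw [← one_div]
      refine div_le_div_of_nonneg_right ?_ (sqrt_nonneg _)
      nlinarith
  have hf0 : f 0 = 0 := by simp [hf]
  have hcont : ContinuousWithinAt f (Ici 0) 0 := by
    rw [ContinuousWithinAt, hf0]
    refine squeeze_zero_norm' (a := fun u => 2 * √u)
      (eventually_mem_nhdsWithin.mono fun u hu => (hfb u hu).1) ?_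
    have : ContinuousWithinAt (fun u : ℝ => 2 * √u) (Ici 0) 0 := by fun_prop
    simpa [ContinuousWithinAt] using this
  have htop : Tendsto f atTop (𝓝 0) := by
    refine squeeze_zero_norm' (a := fun u => 2 * (√u)⁻¹)
      ((eventually_ge_atTop 0).mono fun u hu => (hfb u hu).2) ?_
    simpa using (tendsto_inv_atTop_zero.comp tendsto_sqrt_atTop).const_mul 2
  have key := integral_Ioi_of_hasDerivAt_of_tendsto hcont hderiv hInteg htop
  have hadd : ∫ u in Ioi (0 : ℝ), f' u = (∫ u in Ioi (0 : ℝ), (exp (-r * u) / √u * bernoulliGap u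
      - exp (-(r + 1) * u) / √u * bernoulliGap u)) + ∫ u in Ioi (0 : ℝ),
      (2 * r * (exp (-r * u) / √u) - (2 * r + 1) * (exp (-(r + 1) * u) / √u)) :=
    integral_add (hInteg1.sub hInteg2) (hInteg3.sub hInteg4)
  rw [hf0, sub_zero, hadd, integral_sub hInteg1 hInteg2, integral_sub hInteg3 hInteg4, integral_const_mul, integral_const_mul,
    integral_exp_div_sqrt hr, integral_exp_div_sqrt hr1] at key
  rw [gapTransform, gapTransform]
  have hs : √r ^ 2 = r := sq_sqrt hr.le
  have hs1 : √(r + 1) ^ 2 = r + 1 := sq_sqrt hr1.le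
  have hp := sqrt_pos.mpr hr
  have hp1 := sqrt_pos.mpr hr1
  have e1 : 2 * r * (√π / √r) = √π * (2 * √r) := by
    field_simp; linear_combination -hs
  have e2 : (2 * r + 1) * (√π / √(r + 1)) = √π * (2 * √(r + 1) - 1 / √(r + 1)) := by
    field_simp; linear_combination -2 * hs1
  rw [e1, e2] at key
  linear_combination key

/-! ### ζ(1/2) as a limit of partial sums -/

/-- `(j+2)^{1-s} - (j+1)^{1-s} - (1-s)(j+1)^{-s}`. -/
noncomputable def zetaStep (j : ℕ) (s : ℂ) : ℂ :=
  ((j : ℂ) + 2) ^ (1 - s) - ((j : ℂ) + 1) ^ (1 - s) - (1 - s) * ((j : ℂ) + 1) ^ (-s)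

theorem sum_zetaStep (s : ℂ) (N : ℕ) :
    ∑ j ∈ Finset.range N, zetaStep j s = ((N : ℂ) + 1) ^ (1 - s) - 1 -
      (1 - s) * ∑ j ∈ Finset.range N, 1 / ((j : ℂ) + 1) ^ s := by
  induction N with
  | zero => simp
  | succ N ih =>
    rw [Finset.sum_range_succ, Finset.sum_range_succ, ih, zetaStep, Complex.cpow_neg]
    push_cast
    rw [show (N : ℂ) + 1 + 1 = N + 2 by ring]
    ring

/-- A second-order Taylor remainder of x^{1-s} at j + 1, bounded by two uses of the mean value
inequality; it is summable in j throughout Re s > 0. -/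
theorem norm_zetaStep_le (j : ℕ) {s : ℂ} (hs : 0 < s.re) :
    ‖zetaStep j s‖ ≤ ‖1 - s‖ * ‖s‖ * ((j : ℝ) + 1) ^ (-s.re - 1) := by
  set a : ℝ := (j : ℝ) + 1 with ha
  have hapos : 0 < a := by positivity
  have hder : ∀ (p : ℂ) (x : ℝ), x ∈ Icc a (a + 1) →
      HasDerivAt (fun x : ℝ => (x : ℂ) ^ p) (p * (x : ℂ) ^ (p - 1)) x := fun p x hx =>
    (hasStrictDerivAt_id (x : ℂ)).hasDerivAt.cpow_const
      (Or.inl (by simpa using hapos.trans_le hx.1)) |>.comp_ofReal |> fun h => by simpa using h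
  have hconv : Convex ℝ (Icc a (a + 1)) := convex_Icc _ _
  have hamem : a ∈ Icc a (a + 1) := ⟨le_rfl, by linarith⟩
  have h1 : ∀ x ∈ Icc a (a + 1), ‖(x : ℂ) ^ (-s) - (a : ℂ) ^ (-s)‖ ≤ ‖s‖ * a ^ (-s.re - 1) := by
    intro x hx
    have hb : ∀ y ∈ Icc a (a + 1), ‖-s * (y : ℂ) ^ (-s - 1)‖ ≤ ‖s‖ * a ^ (-s.re - 1) := by
      intro y hy
      rw [norm_mul, norm_neg, Complex.norm_cpow_eq_rpow_re_of_pos (hapos.trans_le hy.1)]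
      refine mul_le_mul_of_nonneg_left ?_ (norm_nonneg _)
      simp only [Complex.sub_re, Complex.neg_re, Complex.one_re]
      exact rpow_le_rpow_of_nonpos hapos hy.1 (by linarith)
    have h := hconv.norm_image_sub_le_of_norm_hasDerivWithin_le
      (fun y hy => (hder (-s) y hy).hasDerivWithinAt) hb hamem hx
    refine h.trans (mul_le_of_le_one_right (by positivity) ?_)
    rw [norm_of_nonneg (by linarith [hx.1])]
    linarith [hx.2]
  have hd : ∀ x ∈ Icc a (a + 1),
      HasDerivWithinAt (fun x : ℝ => (x : ℂ) ^ (1 - s) - (x : ℂ) * ((1 - s) * (a : ℂ) ^ (-s)))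
        ((1 - s) * ((x : ℂ) ^ (-s) - (a : ℂ) ^ (-s))) (Icc a (a + 1)) x := by
    intro x hx
    have h2 := (hder (1 - s) x hx).sub
      ((Complex.ofRealCLM.hasDerivAt (x := x)).mul_const ((1 - s) * (a : ℂ) ^ (-s)))
    convert! h2.hasDerivWithinAt using 1
    rw [show 1 - s - 1 = -s by ring]
    simp
    ring
  have h3 := hconv.norm_image_sub_le_of_norm_hasDerivWithin_le hd
    (C := ‖1 - s‖ * ‖s‖ * a ^ (-s.re - 1)) (fun x hx => by
      rw [norm_mul, mul_assoc]
      exact mul_le_mul_of_nonneg_left (h1 x hx) (norm_nonneg _)) hamem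
    (⟨by linarith, le_rfl⟩ : a + 1 ∈ Icc a (a + 1))
  have e : zetaStep j s = ((a + 1 : ℝ) : ℂ) ^ (1 - s) - ((a + 1 : ℝ) : ℂ) * ((1 - s) *
      (a : ℂ) ^ (-s)) - ((a : ℂ) ^ (1 - s) - (a : ℂ) * ((1 - s) * (a : ℂ) ^ (-s))) := by
    rw [zetaStep, ha]
    push_cast
    rw [show (j : ℂ) + 1 + 1 = j + 2 by ring]
    ring
  rw [e]
  simpa using h3

/-- In the ball of radius 7/4 about 2, which contains 1/2, one has Re s > 1/4 and ‖1 - s‖‖s‖ ≤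
(11/4)(15/4) ≤ 20; hence the constants. -/
theorem summable_zetaStep_bound :
    Summable fun j : ℕ => (20 : ℝ) * ((j : ℝ) + 1) ^ (-(5 / 4) : ℝ) := by
  refine Summable.mul_left _ ?_
  have h : Summable fun n : ℕ => ((n : ℝ)) ^ (-(5 / 4) : ℝ) :=
    summable_nat_rpow.mpr (by norm_num)
  simpa using (summable_nat_add_iff 1).mpr h

theorem norm_zetaStep_le_of_mem_ball (j : ℕ) {s : ℂ} (hs : s ∈ Metric.ball (2 : ℂ) (7 / 4)) :
    ‖zetaStep j s‖ ≤ 20 * ((j : ℝ) + 1) ^ (-(5 / 4) : ℝ) := by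
  rw [mem_ball_iff_norm] at hs
  have hre : 1 / 4 < s.re := by
    have h := (abs_le.mp (Complex.abs_re_le_norm (s - 2))).1
    simp at h
    linarith
  have h1 : ‖s‖ ≤ 15 / 4 := by
    have := norm_add_le (s - 2) 2
    simp at this
    linarith
  have h2 : ‖1 - s‖ ≤ 11 / 4 := by
    have := norm_add_le (2 - s) (-1)
    rw [norm_sub_rev, show 2 - s + -1 = 1 - s by ring, norm_neg, norm_one] at this
    linarith
  refine (norm_zetaStep_le j (by linarith)).trans ?_
  refine mul_le_mul ?_ ?_ (by positivity) (by norm_num)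
  · calc ‖1 - s‖ * ‖s‖ ≤ 11 / 4 * (15 / 4) := mul_le_mul h2 h1 (norm_nonneg _) (by norm_num)
      _ ≤ 20 := by norm_num
  · exact rpow_le_rpow_of_exponent_le (by simp) (by linarith)

theorem one_add_tsum_zetaStep_of_one_lt_re {s : ℂ} (hs : 1 < s.re)
    (hball : s ∈ Metric.ball (2 : ℂ) (7 / 4)) :
    1 + ∑' j, zetaStep j s = riemannZeta₁ s := by
  have hs1 : s ≠ 1 := by rintro rfl; simp at hs
  have hsum : Summable fun j => zetaStep j s :=
    Summable.of_norm_bounded summable_zetaStep_bound fun j => norm_zetaStep_le_of_mem_ball j hball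
  have hz : Summable fun n : ℕ => 1 / ((n : ℂ) + 1) ^ s := by
    simpa using (summable_nat_add_iff 1).mpr (Complex.summable_one_div_nat_cpow.mpr hs)
  have ht := hz.hasSum.tendsto_sum_nat
  rw [← zeta_eq_tsum_one_div_nat_add_one_cpow hs] at ht
  have hpow : Tendsto (fun N : ℕ => ((N : ℂ) + 1) ^ (1 - s)) atTop (𝓝 0) := by
    rw [tendsto_zero_iff_norm_tendsto_zero]
    have h := (tendsto_rpow_neg_atTop (y := s.re - 1) (by linarith)).comp
      (tendsto_natCast_atTop_atTop.comp (tendsto_add_atTop_nat 1))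
    refine h.congr fun N => ?_
    have e : ((N : ℂ) + 1) = ((N + 1 : ℕ) : ℂ) := by push_cast; rfl
    rw [e, Complex.norm_natCast_cpow_of_pos (Nat.succ_pos N)]
    simp
  have h := (hpow.sub_const 1).sub (ht.const_mul (1 - s))
  have h2 := tendsto_nhds_unique hsum.hasSum.tendsto_sum_nat
    (h.congr fun N => (sum_zetaStep s N).symm)
  rw [h2, riemannZeta_eq_inv_sub_mul hs1]
  have : s - 1 ≠ 0 := sub_ne_zero.mpr hs1
  field_simp
  ring

/-- Identity theorem, starting from Re s > 1. Using the entire function (s - 1)ζ(s) keeps the pole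
at 1 out of the ball. -/
theorem one_add_tsum_zetaStep {s : ℂ} (hs : s ∈ Metric.ball (2 : ℂ) (7 / 4)) :
    1 + ∑' j, zetaStep j s = riemannZeta₁ s := by
  have hopen : IsOpen (Metric.ball (2 : ℂ) (7 / 4)) := Metric.isOpen_ball
  have hd : DifferentiableOn ℂ (fun s => ∑' j, zetaStep j s) (Metric.ball (2 : ℂ) (7 / 4)) := by
    refine Complex.differentiableOn_tsum_of_summable_norm summable_zetaStep_bound (fun j => ?_) hopen
      fun j s hs => norm_zetaStep_le_of_mem_ball j hs
    have h1 : (j : ℂ) + 1 ≠ 0 := by exact_mod_cast Nat.succ_ne_zero j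
    have h2 : (j : ℂ) + 2 ≠ 0 := by exact_mod_cast (by omega : j + 2 ≠ 0)
    have hc : ∀ (c : ℂ), c ≠ 0 → ∀ g : ℂ → ℂ, Differentiable ℂ g →
        Differentiable ℂ fun s => c ^ g s := fun c hc g hg =>
      hg.const_cpow (Or.inl hc)
    refine Differentiable.differentiableOn ?_
    unfold zetaStep
    exact ((hc _ h2 _ (by fun_prop)).sub (hc _ h1 _ (by fun_prop))).sub
      ((by fun_prop : Differentiable ℂ fun s : ℂ => 1 - s).mul (hc _ h1 _ (by fun_prop)))
  have ha : AnalyticOnNhd ℂ (fun s => 1 + ∑' j, zetaStep j s) (Metric.ball (2 : ℂ) (7 / 4)) :=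
    (hd.const_add 1).analyticOnNhd hopen
  have hb : AnalyticOnNhd ℂ riemannZeta₁ (Metric.ball (2 : ℂ) (7 / 4)) :=
    differentiable_riemannZeta₁.differentiableOn.analyticOnNhd hopen
  have hmem : (2 : ℂ) ∈ Metric.ball (2 : ℂ) (7 / 4) := Metric.mem_ball_self (by norm_num)
  refine ha.eqOn_of_preconnected_of_eventuallyEq hb (convex_ball _ _).isPreconnected hmem ?_ hs
  have hre : ∀ᶠ s : ℂ in 𝓝 2, 1 < s.re :=
    Complex.continuous_re.continuousAt.eventually (lt_mem_nhds (by norm_num))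
  filter_upwards [hre, hopen.mem_nhds hmem] with s h1 h2
  exact one_add_tsum_zetaStep_of_one_lt_re h1 h2

theorem tendsto_sum_inv_sqrt_sub :
    Tendsto (fun N : ℕ => ((∑ k ∈ Finset.Icc 1 N, 1 / √(k : ℝ) - 2 * √((N : ℝ) + 1) : ℝ) : ℂ))
      atTop (𝓝 (riemannZeta (1 / 2))) := by
  have hball : (1 / 2 : ℂ) ∈ Metric.ball (2 : ℂ) (7 / 4) := by
    rw [mem_ball_iff_norm, show (1 / 2 - 2 : ℂ) = ((-(3 / 2) : ℝ) : ℂ) by push_cast; norm_num,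
      Complex.norm_real]
    norm_num
  have hsum : Summable fun j => zetaStep j (1 / 2) :=
    Summable.of_norm_bounded summable_zetaStep_bound fun j => norm_zetaStep_le_of_mem_ball j hball
  have h := hsum.hasSum.tendsto_sum_nat
  have h2 := one_add_tsum_zetaStep hball
  -- The factor -2 is 1/(s - 1) at s = 1/2.
  have hz : riemannZeta (1 / 2) = -2 * (1 + ∑' j, zetaStep j (1 / 2)) := by
    rw [h2, riemannZeta_eq_inv_sub_mul (by norm_num)]
    norm_num
  rw [hz]
  refine ((h.const_add 1).const_mul (-2)).congr fun N => ?_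
  rw [sum_zetaStep]
  have hsq : ∀ x : ℝ, 0 ≤ x → (x : ℂ) ^ (1 / 2 : ℂ) = ((√x : ℝ) : ℂ) := fun x hx => by
    rw [sqrt_eq_rpow, Complex.ofReal_cpow hx]
    norm_num
  have e1 : ((N : ℂ) + 1) ^ (1 - 1 / 2 : ℂ) = ((√((N : ℝ) + 1) : ℝ) : ℂ) := by
    rw [← hsq _ (by positivity)]
    push_cast
    norm_num
  have e2 : ∑ j ∈ Finset.range N, 1 / ((j : ℂ) + 1) ^ (1 / 2 : ℂ) =
      ((∑ k ∈ Finset.Icc 1 N, 1 / √(k : ℝ) : ℝ) : ℂ) := by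
    have e3 : Finset.Icc 1 N = Finset.Ico 1 (N + 1) := rfl
    rw [e3, Finset.sum_Ico_eq_sum_range, Nat.add_sub_cancel]
    push_cast
    refine Finset.sum_congr rfl fun j _ => ?_
    rw [← hsq _ (by positivity)]
    push_cast
    rw [add_comm]
  rw [e1, e2]
  push_cast
  ring

end

/-! ### The closed form with ζ(1/2) and the two series -/

section
open MeasureTheory Set Filter Topology Real

theorem sum_Icc_one_eq_sum_range (f : ℕ → ℝ) (k : ℕ) :
    ∑ l ∈ Finset.Icc 1 k, f l = ∑ l ∈ Finset.range k, f (l + 1) := by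
  rw [Finset.range_eq_Ico, Finset.sum_Ico_add' f 0 k 1]
  rfl

theorem neg_invSqrtCoeff₂ (k : ℕ) :
    -(invSqrtCoeff₂ k : ℝ) = ∑ l ∈ Finset.Icc 1 k, (((2 * l - 3)‼ : ℝ) / (2 ^ (l - 1) * (l ! : ℝ)))
      * (bernoulli l : ℝ) * (Nat.stirlingFirst k l : ℝ) := by
  rw [invSqrtCoeff₂]
  push_cast [stirlingS]
  rw [Finset.mul_sum, ← Finset.sum_neg_distrib]
  refine Finset.sum_congr rfl fun l _ => ?_
  have h : ((-1 : ℝ) ^ k * (-1) ^ l) * ((-1) ^ k * (-1) ^ l) = 1 := by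
    rw [← pow_add, ← pow_add]
    exact Even.neg_one_pow ⟨k + l, rfl⟩
  rw [pow_succ, pow_add]
  set a := ((2 * l - 3)‼ : ℝ) / (2 ^ (l - 1) * (l ! : ℝ))
  linear_combination (a * (bernoulli l : ℝ) * (Nat.stirlingFirst k l : ℝ)) * h

/-- The Stirling recurrence, once l is shifted: the second family's factor at l + 1 is the first
family's at l. For k ≥ 1 the l = 0 term drops out. -/
theorem invSqrtCoeff₂_succ (k : ℕ) (hk : 1 ≤ k) :
    (invSqrtCoeff₂ (k + 1) : ℝ) = invSqrtCoeff₁ k + k * invSqrtCoeff₂ k := by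
  set h : ℕ → ℝ := fun l =>
    (((2 * l - 3)‼ : ℝ) / (2 ^ (l - 1) * (l ! : ℝ))) * (bernoulli l : ℝ) with hdef
  have h1 : -(invSqrtCoeff₁ k : ℝ) =
      ∑ l ∈ Finset.range (k + 1), h (l + 1) * (Nat.stirlingFirst k l : ℝ) := by
    rw [neg_invSqrtCoeff₁, sum_Icc_one_eq_sum_range, Finset.sum_range_succ' _ k]
    obtain ⟨j, rfl⟩ : ∃ j, k = j + 1 := ⟨k - 1, by omega⟩
    rw [Nat.stirlingFirst_succ_zero, Nat.cast_zero, mul_zero, add_zero]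
    refine Finset.sum_congr rfl fun l _ => ?_
    simp only [hdef]
    rw [show 2 * (l + 1 + 1) - 3 = 2 * (l + 1) - 1 by omega, Nat.add_sub_cancel]
  have h2 : -(invSqrtCoeff₂ k : ℝ) =
      ∑ l ∈ Finset.range (k + 1), h (l + 1) * (Nat.stirlingFirst k (l + 1) : ℝ) := by
    rw [neg_invSqrtCoeff₂, sum_Icc_one_eq_sum_range, Finset.sum_range_succ _ k,
      Nat.stirlingFirst_eq_zero_of_lt (Nat.lt_succ_self k), Nat.cast_zero, mul_zero, add_zero]
  have h3 : -(invSqrtCoeff₂ (k + 1) : ℝ) =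
      ∑ l ∈ Finset.range (k + 1), h (l + 1) * (Nat.stirlingFirst (k + 1) (l + 1) : ℝ) := by
    rw [neg_invSqrtCoeff₂, sum_Icc_one_eq_sum_range]
  have h4 : -(invSqrtCoeff₂ (k + 1) : ℝ) = -(invSqrtCoeff₁ k : ℝ) + k * -(invSqrtCoeff₂ k : ℝ) := by
    rw [h1, h2, h3, Finset.mul_sum, ← Finset.sum_add_distrib]
    refine Finset.sum_congr rfl fun l _ => ?_
    rw [Nat.stirlingFirst_succ_succ]
    push_cast
    ring
  linear_combination -h4

theorem invSqrtCoeff₁_zero : invSqrtCoeff₁ 0 = 0 := by simp [invSqrtCoeff₁]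

theorem invSqrtWeight_zero : invSqrtWeight 0 = 0 := by
  rw [invSqrtWeight, invSqrtCoeff₁_zero]; simp

theorem invSqrtCoeff₁_eq (k : ℕ) : (invSqrtCoeff₁ k : ℝ) = -(invSqrtWeight k * (k ! : ℝ)) := by
  rw [invSqrtWeight, div_mul_cancel₀ _ (by positivity), neg_neg]

theorem invSqrtCoeff₂_one : invSqrtCoeff₂ 1 = 1 / 2 := by
  norm_num [invSqrtCoeff₂, stirlingS, bernoulli_one, Nat.doubleFactorial, Nat.stirlingFirst]

theorem invSqrtCoeff₂_succ_eq (k : ℕ) : (invSqrtCoeff₂ (k + 1) : ℝ) =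
    (k ! : ℝ) * (1 / 2 - ∑ j ∈ Finset.range (k + 1), invSqrtWeight j) := by
  induction k with
  | zero => rw [invSqrtCoeff₂_one]; simp [invSqrtWeight_zero]
  | succ k ih =>
    rw [invSqrtCoeff₂_succ (k + 1) (by omega), ih, invSqrtCoeff₁_eq,
      Finset.sum_range_succ _ (k + 1), Nat.factorial_succ]
    push_cast
    ring

theorem gapTransform_nonneg (r : ℝ) : 0 ≤ gapTransform r :=
  setIntegral_nonneg measurableSet_Ioi fun u hu => mul_nonneg (by positivity) (bernoulliGap_nonneg hu)

theorem gapTransform_div_le (n : ℕ) (hn : 1 ≤ n) : gapTransform n / √π ≤ 1 / (2 * √n) := by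
  have hn' : (0 : ℝ) < n := by exact_mod_cast hn
  have h := (hasSum_invSqrtWeight n hn).nonneg fun k =>
    mul_nonneg (invSqrtWeight_nonneg k) (div_nonneg (by positivity) (shiftedRising_pos n k).le)
  have hs := sqrt_pos.mpr hn'
  rw [le_div_iff₀ (by positivity)]
  have e : gapTransform n / √π * (2 * √n) = 2 * (√n / √π * gapTransform n) := by ring
  rw [e]
  linarith

theorem sum_inv_sqrt_eq (n : ℕ) (hn : 1 ≤ n) :
    ((∑ k ∈ Finset.Icc 1 n, 1 / √(k : ℝ) : ℝ) : ℂ) =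
      ((2 * √(n : ℝ) : ℝ) : ℂ) + riemannZeta (1 / 2) + ((gapTransform n / √π : ℝ) : ℂ) := by
  set Q : ℕ → ℝ := fun n =>
    ∑ k ∈ Finset.Icc 1 n, 1 / √(k : ℝ) - 2 * √(n : ℝ) - gapTransform n / √π with hQ
  have hstep : ∀ m, Q (m + 1 + 1) = Q (m + 1) := by
    intro m
    have h := gapTransform_sub_gapTransform (r := ((m + 1 : ℕ) : ℝ)) (by positivity)
    have hpi : √π ≠ 0 := (sqrt_pos.mpr pi_pos).ne'
    have h2 : gapTransform (m + 1 : ℕ) / √π - gapTransform ((m + 1 : ℕ) + 1) / √π =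
        2 * √((m + 1 : ℕ) + 1) - 2 * √((m + 1 : ℕ) : ℝ) - 1 / √((m + 1 : ℕ) + 1) := by
      rw [← sub_div, h, mul_div_cancel_left₀ _ hpi]
    simp only [hQ]
    rw [Finset.sum_Icc_succ_top (by omega), Nat.cast_succ (m + 1)]
    linear_combination h2
  have hconst : ∀ m, Q (m + 1) = Q n := by
    have h1 : ∀ m, Q (m + 1) = Q 1 := fun m => by
      induction m with
      | zero => rfl
      | succ m ih => rw [hstep, ih]
    obtain ⟨j, rfl⟩ : ∃ j, n = j + 1 := ⟨n - 1, by omega⟩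
    exact fun m => (h1 m).trans (h1 j).symm
  have hinv : Tendsto (fun N : ℕ => 1 / √((N : ℝ) + 1)) atTop (𝓝 0) := by
    simp only [one_div]
    exact tendsto_inv_atTop_zero.comp (tendsto_sqrt_atTop.comp
      (tendsto_atTop_add_const_right _ 1 tendsto_natCast_atTop_atTop))
  have hgap : Tendsto (fun N : ℕ => gapTransform ((N : ℝ) + 1) / √π) atTop (𝓝 0) := by
    refine squeeze_zero (fun N => div_nonneg (gapTransform_nonneg _) (sqrt_nonneg _))
      (fun N => ?_) hinv
    have h := gapTransform_div_le (N + 1) (by omega)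
    push_cast at h
    refine h.trans ?_
    have : 0 < √((N : ℝ) + 1) := sqrt_pos.mpr (by positivity)
    exact one_div_le_one_div_of_le this (by linarith)
  -- The limit for ζ(1/2) pairs the sum up to N with √(N + 1); the term 1/√(N + 1) makes up the
  -- offset.
  have herr : Tendsto (fun N : ℕ => ((1 / √((N : ℝ) + 1) - gapTransform ((N : ℝ) + 1) / √π : ℝ) : ℂ))
      atTop (𝓝 0) := by
    have h := hinv.sub hgap
    rw [sub_zero] at h
    exact_mod_cast (Complex.continuous_ofReal.tendsto 0).comp h
  have hlim := tendsto_sum_inv_sqrt_sub.add herr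
  rw [add_zero] at hlim
  have hQlim : Tendsto (fun _ : ℕ => (Q n : ℂ)) atTop (𝓝 (riemannZeta (1 / 2))) := by
    refine hlim.congr fun N => ?_
    rw [← hconst N, ← Complex.ofReal_add]
    congr 1
    simp only [hQ]
    rw [Finset.sum_Icc_succ_top (by omega)]
    push_cast
    ring
  have hz := tendsto_nhds_unique tendsto_const_nhds hQlim
  rw [← hz]
  simp only [hQ]
  push_cast
  ring

theorem hasSum_invSqrtCoeff₁ (n : ℕ) (hn : 1 ≤ n) :
    HasSum (fun k : ℕ => (invSqrtCoeff₁ (k + 1) : ℝ) / (√(n : ℝ) * shiftedRising n (k + 1)))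
      (gapTransform n / √π - 1 / (2 * √(n : ℝ))) := by
  have hn' : (0 : ℝ) < n := by exact_mod_cast hn
  have hs := (sqrt_pos.mpr hn').ne'
  have hpi : √π ≠ 0 := (sqrt_pos.mpr pi_pos).ne'
  have h := ((hasSum_nat_add_iff' 1).mpr (hasSum_invSqrtWeight n hn)).mul_left (-(1 / √(n : ℝ)))
  rw [Finset.sum_range_one, invSqrtWeight_zero, zero_mul, sub_zero] at h
  convert! h using 1
  · funext k
    have := (shiftedRising_pos n (k + 1)).ne'
    rw [invSqrtCoeff₁_eq]
    field_simp
  · field_simp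
    ring

theorem factorial_succ_le_shiftedRising {n : ℕ} (hn : 1 ≤ n) (k : ℕ) :
    ((k + 1)! : ℝ) ≤ shiftedRising n k := by
  induction k with
  | zero => simp [shiftedRising_zero]
  | succ k ih =>
    rw [shiftedRising_succ, Nat.factorial_succ, mul_comm]
    push_cast
    refine mul_le_mul ih ?_ (by positivity) (shiftedRising_pos n k).le
    have : (1 : ℝ) ≤ n := by exact_mod_cast hn
    linarith

/-- Summation by parts: n times each term is A k - A (k+1) minus a term of the weight series. The
boundary term satisfies A k ≤ 1/(k+1), because (n+1)⋯(n+k) ≥ (k+1)! for n ≥ 1. -/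
theorem hasSum_invSqrtCoeff₂ (n : ℕ) (hn : 1 ≤ n) :
    HasSum (fun k : ℕ => (invSqrtCoeff₂ (k + 1) : ℝ) / shiftedRising n (k + 1))
      (gapTransform n / √π / √(n : ℝ)) := by
  have hn' : (0 : ℝ) < n := by exact_mod_cast hn
  have hs := (sqrt_pos.mpr hn').ne'
  have hpi : √π ≠ 0 := (sqrt_pos.mpr pi_pos).ne'
  set b : ℕ → ℝ := fun k => 1 / 2 - ∑ j ∈ Finset.range (k + 1), invSqrtWeight j with hb
  have hb0 : ∀ k, 0 ≤ b k := fun k => sub_nonneg.mpr (sum_invSqrtWeight_le _)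
  have hb1 : ∀ k, b k ≤ 1 := fun k => by
    have := Finset.sum_nonneg fun j (_ : j ∈ Finset.range (k + 1)) => invSqrtWeight_nonneg j
    simp only [hb]
    linarith
  set A : ℕ → ℝ := fun k => (k ! : ℝ) * b k / shiftedRising n k with hA
  set W : ℕ → ℝ := fun k => invSqrtWeight k * ((k ! : ℝ) / shiftedRising n k) with hW
  have hstep : ∀ k, (invSqrtCoeff₂ (k + 1) : ℝ) / shiftedRising n (k + 1) =
      (A k - A (k + 1) - W (k + 1)) / n := by
    intro k
    have hbs : b (k + 1) = b k - invSqrtWeight (k + 1) := by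
      simp only [hb]
      rw [Finset.sum_range_succ _ (k + 1)]
      ring
    have h1 := (shiftedRising_pos n k).ne'
    have h2 : (n : ℝ) + k + 1 ≠ 0 := by positivity
    rw [invSqrtCoeff₂_succ_eq]
    simp only [hA, hW]
    rw [hbs, shiftedRising_succ, Nat.factorial_succ]
    push_cast
    field_simp
    ring
  have hsum : ∀ K, ∑ k ∈ Finset.range K, (invSqrtCoeff₂ (k + 1) : ℝ) / shiftedRising n (k + 1) =
      (1 / 2 - A K - ∑ k ∈ Finset.range K, W (k + 1)) / n := by
    intro K
    simp only [hstep]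
    rw [← Finset.sum_div, Finset.sum_sub_distrib, Finset.sum_range_sub']
    simp [hA, hb, invSqrtWeight_zero, shiftedRising_zero]
  have hA0 : Tendsto A atTop (𝓝 0) := by
    refine squeeze_zero (fun k => div_nonneg (mul_nonneg (by positivity) (hb0 k))
      (shiftedRising_pos n k).le) (fun k => ?_) tendsto_one_div_add_atTop_nhds_zero_nat
    rw [div_le_div_iff₀ (shiftedRising_pos n k) (by positivity), one_mul]
    refine le_trans ?_ (factorial_succ_le_shiftedRising hn k)
    rw [Nat.factorial_succ]
    push_cast
    have hk : (0 : ℝ) ≤ (k ! : ℝ) * (k + 1) := by positivity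
    nlinarith [mul_le_mul_of_nonneg_left (hb1 k) hk]
  have hWsum := ((hasSum_nat_add_iff' 1).mpr (hasSum_invSqrtWeight n hn)).tendsto_sum_nat
  rw [Finset.sum_range_one, invSqrtWeight_zero, zero_mul, sub_zero] at hWsum
  have hlim := ((hA0.const_sub (1 / 2)).sub hWsum).div_const (n : ℝ)
  -- The terms are nonnegative because the weights sum to at most 1/2, so convergence of partial
  -- sums suffices.
  rw [hasSum_iff_tendsto_nat_of_nonneg]
  · refine Tendsto.congr (fun K => (hsum K).symm) ?_
    convert hlim using 2
    rw [sub_zero, sub_sub_cancel, div_div, div_mul_eq_mul_div, div_div,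
      div_eq_div_iff (mul_ne_zero hpi hs) (mul_ne_zero hpi hn'.ne')]
    linear_combination (-gapTransform n * √π) * sq_sqrt hn'.le
  · intro k
    rw [invSqrtCoeff₂_succ_eq]
    exact div_nonneg (mul_nonneg (by positivity) (hb0 k)) (shiftedRising_pos n (k + 1)).le

end

/-! ### Numerical coefficients and conclusion -/

theorem bernoulli_three_four_five :
    bernoulli 3 = 0 ∧ bernoulli 4 = -1 / 30 ∧ bernoulli 5 = 0 := by
  refine ⟨bernoulli_eq_zero_of_odd (by decide) (by norm_num), ?_,
    bernoulli_eq_zero_of_odd (by decide) (by norm_num)⟩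
  rw [bernoulli_eq_bernoulli'_of_ne_one (by norm_num), bernoulli'_four]

theorem invSqrtCoeff₁_values : invSqrtCoeff₁ 1 = -1 / 24 ∧ invSqrtCoeff₁ 2 = -1 / 24 ∧
    invSqrtCoeff₁ 3 = -31 / 384 ∧ invSqrtCoeff₁ 4 = -15 / 64 := by
  obtain ⟨h3, h4, h5⟩ := bernoulli_three_four_five
  refine ⟨?_, ?_, ?_, ?_⟩ <;>
  norm_num [invSqrtCoeff₁, stirlingS, Finset.sum_Icc_succ_top, bernoulli_two, h3, h4, h5,
    Nat.doubleFactorial, Nat.factorial, Nat.stirlingFirst]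

theorem invSqrtCoeff₂_values : invSqrtCoeff₂ 1 = 1 / 2 ∧ invSqrtCoeff₂ 2 = 11 / 24 ∧
    invSqrtCoeff₂ 3 = 7 / 8 ∧ invSqrtCoeff₂ 4 = 977 / 384 := by
  obtain ⟨h3, h4, h5⟩ := bernoulli_three_four_five
  refine ⟨?_, ?_, ?_, ?_⟩ <;>
  norm_num [invSqrtCoeff₂, stirlingS, Finset.sum_Icc_succ_top, bernoulli_one, bernoulli_two, h3, h4,
    Nat.doubleFactorial, Nat.factorial, Nat.stirlingFirst]

theorem mainTheorem6 :
    (∀ n : ℕ, 1 ≤ n →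
      (Summable fun k : ℕ =>
          (invSqrtCoeff₁ (k + 1) : ℝ) / (√(n : ℝ) * shiftedRising n (k + 1))) ∧
      ((∑ k ∈ Finset.Icc 1 n, 1 / √(k : ℝ) : ℝ) : ℂ) =
        ((2 * √(n : ℝ) : ℝ) : ℂ) + riemannZeta (1 / 2) + ((1 / (2 * √(n : ℝ)) : ℝ) : ℂ) +
          ((∑' k : ℕ,
            (invSqrtCoeff₁ (k + 1) : ℝ) / (√(n : ℝ) * shiftedRising n (k + 1)) : ℝ) : ℂ) ∧
      (Summable fun k : ℕ => (invSqrtCoeff₂ (k + 1) : ℝ) / shiftedRising n (k + 1)) ∧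
      ((∑ k ∈ Finset.Icc 1 n, 1 / √(k : ℝ) : ℝ) : ℂ) =
        ((2 * √(n : ℝ) : ℝ) : ℂ) + riemannZeta (1 / 2) +
          ((√(n : ℝ) *
            ∑' k : ℕ, (invSqrtCoeff₂ (k + 1) : ℝ) / shiftedRising n (k + 1) : ℝ) : ℂ)) ∧
    (invSqrtCoeff₁ 1 = -1 / 24 ∧ invSqrtCoeff₁ 2 = -1 / 24 ∧
      invSqrtCoeff₁ 3 = -31 / 384 ∧ invSqrtCoeff₁ 4 = -15 / 64) ∧
    (invSqrtCoeff₂ 1 = 1 / 2 ∧ invSqrtCoeff₂ 2 = 11 / 24 ∧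
      invSqrtCoeff₂ 3 = 7 / 8 ∧ invSqrtCoeff₂ 4 = 977 / 384) := by
  refine ⟨fun n hn => ?_, invSqrtCoeff₁_values, invSqrtCoeff₂_values⟩
  have hn' : (0 : ℝ) < n := by exact_mod_cast hn
  have hs := (Real.sqrt_pos.mpr hn').ne'
  have h1 := hasSum_invSqrtCoeff₁ n hn
  have h2 := hasSum_invSqrtCoeff₂ n hn
  refine ⟨h1.summable, ?_, h2.summable, ?_⟩
  · rw [h1.tsum_eq, sum_inv_sqrt_eq n hn]
    push_cast
    ring
  · rw [h2.tsum_eq, sum_inv_sqrt_eq n hn, mul_div_cancel₀ _ hs]
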